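/- **Conventions.** A Turing machine $T=(Q,q_0,q_{halt},\Sigma,\delta)$ has a finite set $Q$ of states, numbered $1,\dots,r$, the alphabet $\Sigma=\{0,1,\dots,9\}$ with blank symbol $0$, and a transition function $\delta:Q\times\Sigma\to Q\times\Sigma\times\{-1,0,1\}$. A configuration is a pair $(q,t)$ with $q\in Q$ and a tape $t\in\Sigma^{\mathbb Z}$ with only finitely many non-blank symbols. One step of $T$ fixes $(q_{halt},t)$; if $q\neq q_{halt}$ and $\delta(q,t_0)=(q',t_0',\epsilon)$, it replaces $q$ by $q'$ and $t_0$ by $t_0'$ and then shifts the tape by $\epsilon$ ($\epsilon=1$ is the left shift, $\epsilon=-1$ the right shift). If $t_i=0$ for $|i|>k_0$, the configuration $(q,t)$ is encoded by the point $(y_1,y_2,q)\in\mathbb N^3$, where $$y_1=t_0+t_1\cdot 10+\dots+t_{k_0}\cdot 10^{k_0},\qquad y_2=t_{-1}+t_{-2}\cdot 10+\dots+t_{-k_0}\cdot 10^{k_0-1}.$$ For $x_0\in\mathbb N^3$ and $t^*=(t^*_{-k},\dots,t^*_k)\in\Sigma^{2k+1}$ we say that $T$ halts on input $x_0$ with output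 matching $t^*$ if $x_0$ encodes a configuration and $T$, started from it, reaches the state $q_{halt}$ with a tape whose positions $-k,\dots,k$ carry $t^*_{-k},\dots,t^*_k$. The orbit of a vector field through a point is the set of points reached in positive or negative time by its integral curve starting at that point. **Proposition 3.2.** Let $T$ be a Turing machine as above. There are $m\in\mathbb N$, a polynomial vector field $p_T:\mathbb R^{m+4}\to\mathbb R^{m+4}$ whose coefficients are computable real numbers, a point $y_0\in\mathbb R^m$ with computable coordinates, and constants $0<\delta\le\frac12$, $0<\varepsilon\le\frac14$ such that the following holds. Write points of $\mathbb R^{m+4}$ as $(\omega,z_1,z_2)\in\mathbb R\times\mathbb R^3\times\mathbb R^m$. 1. $\omega$ is a clock variable: the first component of $p_T$ is the constant $1$. That is, the autonomous ODE $\frac{dZ}{d\tau}=p_T(Z)$ has the form $\omega'=1$, $z'=\widetilde p_T(\omega,z)$ with $z=(z_1,z_2)$, and arises from the non-autonomous polynomial ODE $\frac{dz}{d\tau}=\widetilde p_T(\tau,z)$ by adding the clock $\omega$. 2. For every integer $k\ge 0$ and every $t^*=(t^*_{-k},\dots,t^*_k)\in\Sigma^{2k+1}$ there is an open set $U_{t^*}\subset\mathbb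 R^{m+4}$, namely $$U_{t^*}=\Big(\bigcup_{i\in\mathbb N}(i,i+\delta)\Big)\times U^{t^*}_\varepsilon\times\mathbb R^m ,$$ where $\mathbb N=\{0,1,2,\dots\}$ and $U^{t^*}_\varepsilon\subset\mathbb R^3$ is the $\varepsilon$-neighbourhood of the set of points encoding configurations $(q_{halt},\bar t)$ such that $\bar t$ carries $t^*_{-k},\dots,t^*_k$ in the positions $-k,\dots,k$, with the following property: for every $x_0\in\mathbb N^3\subset\mathbb R^3$, the orbit of $p_T$ through $(0,x_0,y_0)$ meets $U_{t^*}$ if and only if $T$ halts on input $x_0$ with output matching $t^*$. -/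

import Mathlib

/-- A Turing machine with set of states `Q` and alphabet `S`: initial state, halting state and
transition function `δ : Q × S → Q × S × {-1, 0, 1}` (`SignType` is the type `{-1, 0, 1}`).
Finiteness of `Q` and `S` is imposed where machines are used. -/
structure TuringMachine (Q S : Type*) where
  /-- the initial state -/
  q₀ : Q
  /-- the halting state -/
  qhalt : Q
  /-- the transition function -/
  δ : Q × S → Q × S × SignType

namespace TuringMachine

/-- Configurations: current state and current two-sided tape; the head reads position `0`. -/
abbrev Config (Q S : Type*) := Q × (ℤ → S)

open Classical in
/-- The global transition function `Δ`. A halted configuration is fixed. Otherwise, with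
`δ (q, t 0) = (q', s', ε)`, the state becomes `q'`, the symbol at position `0` becomes `s'`, and the
tape is shifted by `ε`, where `ε = 1` is the left shift `t ↦ (n ↦ t (n + 1))` and `ε = -1` is the
right shift. -/
noncomputable def step {Q S : Type*} (T : TuringMachine Q S) (c : Config Q S) : Config Q S :=
  if c.1 = T.qhalt then c
  else
    let r := T.δ (c.1, c.2 0)
    (r.1, fun n => Function.update c.2 0 r.2.1 (n + ((r.2.2 : SignType) : ℤ)))

/-- The tape `t` carries the finite string `s = (s₋ₖ, …, sₖ)` in the positions `-k, …, k`. -/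
def Carries {S : Type*} {k : ℕ} (t : ℤ → S) (s : Set.Icc (-(k : ℤ)) (k : ℤ) → S) : Prop :=
  ∀ n : Set.Icc (-(k : ℤ)) (k : ℤ), t n = s n

/-- Started from the configuration `c`, the machine halts, and its output tape (the tape at the
moment of halting) carries the string `s` in the positions `-k, …, k`. Halted configurations are
fixed by `step`, so the output does not depend on the choice of `j`. -/
def HaltsWith {Q S : Type*} (T : TuringMachine Q S) (c : Config Q S) {k : ℕ}
    (s : Set.Icc (-(k : ℤ)) (k : ℤ) → S) : Prop :=
  ∃ j : ℕ, (T.step^[j] c).1 = T.qhalt ∧ Carries (T.step^[j] c).2 s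

/-- The encoding of configurations by points of `ℕ³`. The alphabet is `{0, …, 9}` with blank symbol
`0`, and the states are numbered `1, …, r` through `e` (the state `q` has number `e q + 1`).
`IsCode e c x` says that the tape `t` of `c = (q, t)` is of the form
`… 0 0 t₋ₖ₀ … tₖ₀ 0 0 …` for some `k₀`, and that `x = (y₁, y₂, number of q)` with
`y₁ = t₀ + t₁ 10 + ⋯ + tₖ₀ 10 ^ k₀` and `y₂ = t₋₁ + t₋₂ 10 + ⋯ + t₋ₖ₀ 10 ^ (k₀ - 1)`. -/
def IsCode {Q : Type*} {r : ℕ} (e : Q ≃ Fin r) (c : Config Q (Fin 10)) (x : ℕ × ℕ × ℕ) : Prop :=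
  ∃ k₀ : ℕ, (∀ n : ℤ, (k₀ : ℤ) < |n| → c.2 n = 0) ∧
    x.1 = ∑ i ∈ Finset.range (k₀ + 1), (c.2 (i : ℤ) : ℕ) * 10 ^ i ∧
    x.2.1 = ∑ i ∈ Finset.range k₀, (c.2 (-((i : ℤ) + 1)) : ℕ) * 10 ^ i ∧
    x.2.2 = (e c.1 : ℕ) + 1

/-- "The machine with input `x ∈ ℕ³` halts with an output whose positions `-k, …, k` correspond to
`s`": `x` encodes a configuration, and the machine started there halts with such an output. (Points
of `ℕ³` that encode no configuration are not inputs on which the machine halts.) -/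
def HaltsOnCode {Q : Type*} {r : ℕ} (T : TuringMachine Q (Fin 10)) (e : Q ≃ Fin r)
    (x : ℕ × ℕ × ℕ) {k : ℕ} (s : Set.Icc (-(k : ℤ)) (k : ℤ) → Fin 10) : Prop :=
  ∃ c : Config Q (Fin 10), IsCode e c x ∧ T.HaltsWith c s

/-- The set `V × U_ε × ℝᵐ ⊆ ℝ^(m+4)`, in coordinates `(ω, z₁, z₂) ∈ ℝ × ℝ³ × ℝᵐ`, where
`V = ⋃ i : ℕ, (i, i + δ)` and `U_ε` is the (Euclidean) `ε`-neighbourhood in `ℝ³` of the set of codes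
of the configurations `(q_halt, t)` whose tape `t` carries `s` in the positions `-k, …, k`. -/
def outputRegion {Q : Type*} {r : ℕ} (T : TuringMachine Q (Fin 10)) (e : Q ≃ Fin r) (m : ℕ)
    (δ ε : ℝ) {k : ℕ} (s : Set.Icc (-(k : ℤ)) (k : ℤ) → Fin 10) : Set (Fin (m + 4) → ℝ) :=
  {Z | (∃ i : ℕ, Z 0 ∈ Set.Ioo (i : ℝ) (i + δ)) ∧
    ∃ (c : Config Q (Fin 10)) (x : ℕ × ℕ × ℕ), IsCode e c x ∧ c.1 = T.qhalt ∧ Carries c.2 s ∧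
      (Z 1 - x.1) ^ 2 + (Z 2 - x.2.1) ^ 2 + (Z 3 - x.2.2) ^ 2 < ε ^ 2}

end TuringMachine

/-- The polynomial vector field on `ℝⁿ` with components `p i`. -/
noncomputable def polyField {n : ℕ} (p : Fin n → MvPolynomial (Fin n) ℝ) (Z : Fin n → ℝ) :
    Fin n → ℝ :=
  fun i => MvPolynomial.eval Z (p i)

/-- The orbit of the vector field `X` through `Z₀`: all points reached, in positive or negative
time, by integral curves of `X` on open intervals around `0` that start at `Z₀` at time `0`. -/
def orbitThrough {n : ℕ} (X : (Fin n → ℝ) → (Fin n → ℝ)) (Z₀ : Fin n → ℝ) : Set (Fin n → ℝ) :=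
  {W | ∃ (a b : ℝ) (Z : ℝ → Fin n → ℝ), a < 0 ∧ 0 < b ∧ Z 0 = Z₀ ∧
    IsIntegralCurveOn Z (fun _ => X) (Set.Ioo a b) ∧ ∃ τ ∈ Set.Ioo a b, Z τ = W}

/-- `x` is a computable real number: there is a recursive sequence of rational numbers
`(-1) ^ s l * a l / b l` that converges to `x` with error at most `2 ^ (-l)`. -/
def IsComputableReal (x : ℝ) : Prop :=
  ∃ a b s : ℕ → ℕ, Computable a ∧ Computable b ∧ Computable s ∧ (∀ l, b l ≠ 0) ∧
    ∀ l, |x - (-1) ^ s l * (a l : ℝ) / (b l : ℝ)| ≤ (1 / 2) ^ l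

/-- The point `(0, x, y) ∈ ℝ × ℝ³ × ℝᵐ = ℝ^(m+4)`. -/
def initialPoint {m : ℕ} (x : ℕ × ℕ × ℕ) (y : Fin m → ℝ) : Fin (m + 4) → ℝ :=
  Matrix.vecCons 0
    (Matrix.vecCons (x.1 : ℝ) (Matrix.vecCons (x.2.1 : ℝ) (Matrix.vecCons (x.2.2 : ℝ) y)))

theorem isComputableReal_ratCast (q : ℚ) : IsComputableReal (q : ℝ) := by
  refine ⟨fun _ => q.num.natAbs, fun _ => q.den, fun _ => if q.num < 0 then 1 else 0,
    Computable.const _, Computable.const _, Computable.const _, fun _ => q.den_nz, fun l => ?_⟩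
  have h : (-1 : ℝ) ^ (if q.num < 0 then 1 else 0) * (q.num.natAbs : ℝ) = q.num := by
    rw [Nat.cast_natAbs]
    split_ifs with h
    · rw [abs_of_neg h]; push_cast; ring
    · rw [abs_of_nonneg (not_lt.1 h)]; simp
  have h2 : (q : ℝ) = q.num / q.den := by exact_mod_cast (Rat.num_div_den q).symm
  rw [h, ← h2]
  simp

theorem primrec_prod_range {f : ℕ → ℕ} (hf : Primrec f) :
    Primrec fun n => ∏ i ∈ Finset.range n, f i := by
  have h : Primrec fun n : ℕ => (Nat.rec 1 (fun i p => p * f i) n : ℕ) :=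
    Primrec.nat_rec₁ 1 (Primrec.nat_mul.comp Primrec.snd (hf.comp Primrec.fst))
  refine h.of_eq fun n => ?_
  induction n with
  | zero => simp
  | succ n ih => rw [Finset.prod_range_succ, ← ih]

theorem isComputableReal_two_pi : IsComputableReal (2 * Real.pi) := by
  have hpow : Primrec fun l : ℕ => 2 ^ (l + 2) := by
    refine ((primrec_prod_range (Primrec.const 2)).comp
      (Primrec.nat_add.comp Primrec.id (Primrec.const 2))).of_eq fun n => ?_
    simp
  have hnum : Primrec fun i : ℕ => (2 * i + 2) * (2 * i + 2) := by
    have : Primrec fun i : ℕ => 2 * i + 2 :=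
      Primrec.nat_add.comp (Primrec.nat_mul.comp (Primrec.const 2) Primrec.id) (Primrec.const 2)
    exact Primrec.nat_mul.comp this this
  have hden : Primrec fun i : ℕ => (2 * i + 1) * (2 * i + 3) :=
    Primrec.nat_mul.comp
      (Primrec.nat_add.comp (Primrec.nat_mul.comp (Primrec.const 2) Primrec.id) (Primrec.const 1))
      (Primrec.nat_add.comp (Primrec.nat_mul.comp (Primrec.const 2) Primrec.id) (Primrec.const 3))
  refine ⟨fun l => 4 * ∏ i ∈ Finset.range (2 ^ (l + 2)), (2 * i + 2) * (2 * i + 2),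
    fun l => ∏ i ∈ Finset.range (2 ^ (l + 2)), (2 * i + 1) * (2 * i + 3), fun _ => 0,
    (Primrec.nat_mul.comp (Primrec.const 4) ((primrec_prod_range hnum).comp hpow)).to_comp,
    ((primrec_prod_range hden).comp hpow).to_comp, Computable.const _, fun l => ?_, fun l => ?_⟩
  · exact Finset.prod_ne_zero_iff.2 fun i _ => by positivity
  · have hW : (-1 : ℝ) ^ 0 * ((4 * ∏ i ∈ Finset.range (2 ^ (l + 2)), (2 * i + 2) * (2 * i + 2) : ℕ) :
        ℝ) / ((∏ i ∈ Finset.range (2 ^ (l + 2)), (2 * i + 1) * (2 * i + 3) : ℕ) : ℝ) =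
        4 * Real.Wallis.W (2 ^ (l + 2)) := by
      push_cast
      rw [Real.Wallis.W, pow_zero, one_mul, mul_div_assoc, ← Finset.prod_div_distrib]
      congr 1
      refine Finset.prod_congr rfl fun i _ => ?_
      rw [div_mul_div_comm]
    rw [hW]
    have h1 := Real.Wallis.W_le (2 ^ (l + 2))
    have h2 := Real.Wallis.le_W (2 ^ (l + 2))
    have hp := Real.pi_lt_four
    have hp0 := Real.pi_pos
    rw [abs_of_nonneg (by linarith), one_div, inv_pow]
    push_cast at h2
    generalize Real.Wallis.W (2 ^ (l + 2)) = w at h1 h2 ⊢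
    rw [pow_add] at h2
    set y : ℝ := 2 ^ l
    have hy : 0 < y := by positivity
    rw [div_mul_eq_mul_div, div_le_iff₀ (by positivity)] at h2
    rw [← one_div, le_div_iff₀ hy]
    linarith

section

open Set

/-- The nearest point projection of `ℝⁿ` onto the cube `[-R, R]ⁿ`. -/
noncomputable def clampCube {n : ℕ} (R : ℝ) (x : Fin n → ℝ) : Fin n → ℝ :=
  fun i => max (-R) (min R (x i))

theorem lipschitzWith_clampCube {n : ℕ} (R : ℝ) : LipschitzWith 1 (clampCube (n := n) R) := by
  refine LipschitzWith.of_dist_le_mul fun x y => ?_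
  rw [NNReal.coe_one, one_mul, dist_pi_le_iff dist_nonneg]
  intro i
  have h := ((LipschitzWith.eval (α := fun _ : Fin n => ℝ) i).const_min R).const_max (-R)
  simpa [clampCube] using h.dist_le_mul x y

theorem clampCube_mem {n : ℕ} {R : ℝ} (hR : 0 ≤ R) (x : Fin n → ℝ) :
    clampCube R x ∈ Icc (fun _ => -R) (fun _ => R) :=
  ⟨fun _ => le_max_left _ _, fun _ => max_le (by linarith) (min_le_left _ _)⟩

theorem clampCube_of_abs_le {n : ℕ} {R : ℝ} {x : Fin n → ℝ} (h : ∀ i, |x i| ≤ R) :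
    clampCube R x = x := by
  funext i
  obtain ⟨h1, h2⟩ := abs_le.1 (h i)
  simp [clampCube, h1, h2]

theorem exists_integralCurve_of_lipschitz_bounded {n : ℕ} {X : (Fin n → ℝ) → Fin n → ℝ}
    {C L : NNReal} (hC : LipschitzWith C X) (hL : ∀ x, ‖X x‖ ≤ L) (Z₀ : Fin n → ℝ) {T : ℝ}
    (hT : 0 < T) :
    ∃ Z : ℝ → Fin n → ℝ, Z 0 = Z₀ ∧ ∀ t ∈ Ioo (-T) T, HasDerivAt Z (X (Z t)) t := by
  have hp : IsPicardLindelof (fun _ => X) (tmin := -T) (tmax := T)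
      ⟨0, by constructor <;> linarith⟩ Z₀ (L * T.toNNReal) 0 L C :=
    { lipschitzOnWith := fun _ _ => hC.lipschitzOnWith
      continuousOn := fun _ _ => continuousOn_const
      norm_le := fun _ _ x _ => hL x
      mul_max_le := by simp [hT.le] }
  obtain ⟨Z, h0, hZ⟩ := hp.exists_eq_forall_mem_Icc_hasDerivWithinAt₀
  exact ⟨Z, h0, fun t ht => (hZ t (Ioo_subset_Icc_self ht)).hasDerivAt (Icc_mem_nhds ht.1 ht.2)⟩

/-- A `C¹` vector field whose solutions from `Z₀` obey an a priori bound on `[0, T]` has an integral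
curve through `Z₀` on an open interval that contains `[0, T)`. -/
theorem exists_integralCurve_of_apriori_bound {n : ℕ} {X : (Fin n → ℝ) → Fin n → ℝ}
    (hX : ContDiff ℝ 1 X) (Z₀ : Fin n → ℝ) {T R : ℝ} (hT : 0 < T)
    (hR : ∀ (Z : ℝ → Fin n → ℝ), ∀ t ∈ Icc 0 T, Z 0 = Z₀ →
      (∀ s ∈ Icc 0 t, HasDerivAt Z (X (Z s)) s) → ∀ i, |Z t i| < R) :
    ∃ (Z : ℝ → Fin n → ℝ) (a : ℝ), a < 0 ∧ Z 0 = Z₀ ∧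
      IsIntegralCurveOn Z (fun _ => X) (Ioo a T) := by
  have h0R : ∀ i, |Z₀ i| < R := by
    have := hR (fun s => Z₀ + s • X Z₀) 0 ⟨le_rfl, hT.le⟩ (by simp) (by
      intro s hs
      obtain rfl : s = 0 := le_antisymm hs.2 hs.1
      simpa using ((hasDerivAt_id (0 : ℝ)).smul_const (X Z₀)).const_add Z₀)
    simpa using this
  rcases isEmpty_or_nonempty (Fin n) with hn | ⟨⟨i₀⟩⟩
  · refine ⟨fun _ => Z₀, -1, by norm_num, rfl, fun t _ => ?_⟩
    have : X Z₀ = 0 := Subsingleton.elim _ _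
    simpa [this] using hasDerivWithinAt_const t (Ioo (-1) T) Z₀
  have hRpos : 0 ≤ R := (abs_nonneg _).trans (h0R i₀).le
  have hcpt : IsCompact (Icc (fun _ : Fin n => -R) (fun _ => R)) := isCompact_Icc
  obtain ⟨C, hC⟩ := hX.contDiffOn.exists_lipschitzOnWith one_ne_zero (convex_Icc _ _) hcpt
  obtain ⟨L, hL⟩ := hcpt.exists_bound_of_continuousOn hX.continuous.continuousOn
  have hLip : LipschitzWith C (X ∘ clampCube R) := by
    have := hC.comp (lipschitzWith_clampCube R).lipschitzOnWith (s := univ)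
      fun x _ => clampCube_mem hRpos x
    rw [mul_one] at this
    exact lipschitzOnWith_univ.1 this
  obtain ⟨Z, hZ0, hZ⟩ := exists_integralCurve_of_lipschitz_bounded (L := L.toNNReal) hLip
    (fun x => (hL _ (clampCube_mem hRpos x)).trans (Real.le_coe_toNNReal L)) Z₀
    (show 0 < T + 1 by linarith)
  have hcont : ContinuousOn Z (Ioo (-(T + 1)) (T + 1)) := fun t ht =>
    (hZ t ht).continuousAt.continuousWithinAt
  have hsub : Icc 0 T ⊆ Ioo (-(T + 1)) (T + 1) := fun t ht =>
    ⟨by linarith [ht.1], by linarith [ht.2]⟩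
  have hev : ∀ t ∈ Ioo (-(T + 1)) (T + 1), (∀ i, |Z t i| < R) →
      ∀ᶠ s in nhds t, ∀ i, |Z s i| < R := by
    intro t ht h
    rw [Filter.eventually_all]
    intro i
    have hc : ContinuousAt (fun s => |Z s i|) t :=
      ((continuous_apply i).continuousAt.comp (hZ t ht).continuousAt).abs
    exact hc.eventually_lt_const (h i)
  have htrue : ∀ t ∈ Ioo (-(T + 1)) (T + 1), (∀ i, |Z t i| ≤ R) → HasDerivAt Z (X (Z t)) t := by
    intro t ht h
    have := hZ t ht
    rwa [Function.comp_apply, clampCube_of_abs_le h] at this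
  have hstay : ∀ t ∈ Icc 0 T, ∀ i, |Z t i| < R := by
    by_contra! hne
    obtain ⟨t₁, ht₁, i₁, hi₁⟩ := hne
    have hci : ∀ i, ContinuousOn (fun t => |Z t i|) (Icc 0 T) := fun i =>
      ((continuous_apply i).comp_continuousOn (hcont.mono hsub)).abs
    have hclosed : IsClosed (⋃ i, Icc 0 T ∩ (fun t => |Z t i|) ⁻¹' Ici R) :=
      isClosed_iUnion_of_finite fun i => (hci i).preimage_isClosed_of_isClosed isClosed_Icc isClosed_Ici
    obtain ⟨t, htS, hleast⟩ := (isCompact_Icc.of_isClosed_subset hclosed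
      (iUnion_subset fun i => inter_subset_left)).exists_isLeast
      ⟨t₁, mem_iUnion.2 ⟨i₁, ht₁, hi₁⟩⟩
    obtain ⟨i, ht, hi⟩ := mem_iUnion.1 htS
    have hlt : ∀ s ∈ Ico 0 t, ∀ i, |Z s i| < R := by
      intro s hs i
      by_contra! h
      exact hs.2.not_ge (hleast (mem_iUnion.2 ⟨i, ⟨hs.1, hs.2.le.trans ht.2⟩, h⟩))
    have htpos : 0 < t := by
      refine lt_of_le_of_ne ht.1 fun h => ?_
      have := h0R i
      rw [← hZ0, h] at this
      exact this.not_ge hi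
    have hle : ∀ s ∈ Icc 0 t, ∀ i, |Z s i| ≤ R := by
      intro s hs i
      rcases hs.2.lt_or_eq with h | rfl
      · exact (hlt s ⟨hs.1, h⟩ i).le
      · have hc : ContinuousAt (fun s => |Z s i|) s :=
          ((continuous_apply i).continuousAt.comp (hZ s (hsub ht)).continuousAt).abs
        refine le_of_tendsto (hc.tendsto.mono_left (nhdsWithin_le_nhds (s := Iio s))) ?_
        filter_upwards [Ico_mem_nhdsLT htpos] with r hr
        exact (hlt r hr i).le
    exact (hR Z t ht hZ0 (fun s hs => htrue s (hsub ⟨hs.1, hs.2.trans ht.2⟩) (hle s hs)) i).not_ge hi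
  obtain ⟨a, ha, hab⟩ : ∃ a < 0, ∀ t ∈ Ioc a 0, -(T + 1) < t ∧ ∀ i, |Z t i| < R := by
    have h1 := hev 0 ⟨by linarith, by linarith⟩ (hstay 0 ⟨le_rfl, hT.le⟩)
    have h2 : ∀ᶠ s : ℝ in nhds 0, -(T + 1) < s := lt_mem_nhds (by linarith)
    obtain ⟨l, u, hlu, h⟩ := mem_nhds_iff_exists_Ioo_subset.1 (h2.and h1)
    exact ⟨l, hlu.1, fun t ht => h ⟨ht.1, ht.2.trans_lt hlu.2⟩⟩
  refine ⟨Z, a, ha, hZ0, fun t ht => (htrue t ?_ fun i => ?_).hasDerivWithinAt⟩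
  · rcases le_or_gt t 0 with h | h
    · exact ⟨(hab t ⟨ht.1, h⟩).1, by linarith⟩
    · exact hsub ⟨h.le, ht.2.le⟩
  · rcases le_or_gt t 0 with h | h
    · exact ((hab t ⟨ht.1, h⟩).2 i).le
    · exact (hstay t ⟨h.le, ht.2.le⟩ i).le

end

section

open Set

/-! ### Barriers for scalar differential inequalities -/

theorem mul_sub_le_of_le_hasDerivAt {f f' : ℝ → ℝ} {c t₀ t₁ : ℝ} (h01 : t₀ ≤ t₁)
    (hf : ∀ t ∈ Icc t₀ t₁, HasDerivAt f (f' t) t) (hc : ∀ t ∈ Icc t₀ t₁, c ≤ f' t) :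
    c * (t₁ - t₀) ≤ f t₁ - f t₀ := by
  refine (convex_Icc t₀ t₁).mul_sub_le_image_sub_of_le_deriv
    (fun t ht => (hf t ht).continuousAt.continuousWithinAt)
    (fun t ht => (hf t (interior_subset ht)).differentiableAt.differentiableWithinAt)
    (fun t ht => ?_) t₀ ⟨le_rfl, h01⟩ t₁ ⟨h01, le_rfl⟩ h01
  rw [(hf t (interior_subset ht)).deriv]
  exact hc t (interior_subset ht)

theorem abs_le_of_barrier {y y' b b' : ℝ → ℝ} {t₀ t₁ : ℝ} (h01 : t₀ ≤ t₁)
    (hy : ∀ t ∈ Icc t₀ t₁, HasDerivAt y (y' t) t) (hb : ∀ t ∈ Icc t₀ t₁, HasDerivAt b (b' t) t)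
    (h0 : |y t₀| ≤ b t₀) (hup : ∀ t ∈ Icc t₀ t₁, y t = b t → y' t < b' t)
    (hlo : ∀ t ∈ Icc t₀ t₁, -y t = b t → -y' t < b' t) : |y t₁| ≤ b t₁ := by
  have hbc : ContinuousOn b (Icc t₀ t₁) := fun t ht => (hb t ht).continuousAt.continuousWithinAt
  have hyc : ContinuousOn y (Icc t₀ t₁) := fun t ht => (hy t ht).continuousAt.continuousWithinAt
  rw [abs_le'] at h0 ⊢
  exact ⟨image_le_of_deriv_right_lt_deriv_boundary' hyc
      (fun t ht => (hy t (Ico_subset_Icc_self ht)).hasDerivWithinAt) h0.1 hbc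
      (fun t ht => (hb t (Ico_subset_Icc_self ht)).hasDerivWithinAt)
      (fun t ht => hup t (Ico_subset_Icc_self ht)) ⟨h01, le_rfl⟩,
    image_le_of_deriv_right_lt_deriv_boundary' hyc.neg
      (fun t ht => (hy t (Ico_subset_Icc_self ht)).neg.hasDerivWithinAt) h0.2 hbc
      (fun t ht => (hb t (Ico_subset_Icc_self ht)).hasDerivWithinAt)
      (fun t ht => hlo t (Ico_subset_Icc_self ht)) ⟨h01, le_rfl⟩⟩

theorem abs_sub_le_of_abs_deriv_le {y y' D D' : ℝ → ℝ} {t₀ t₁ : ℝ} (h01 : t₀ ≤ t₁)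
    (hy : ∀ t ∈ Icc t₀ t₁, HasDerivAt y (y' t) t) (hD : ∀ t ∈ Icc t₀ t₁, HasDerivAt D (D' t) t)
    (h : ∀ t ∈ Icc t₀ t₁, |y' t| ≤ D' t) : |y t₁ - y t₀| ≤ D t₁ - D t₀ := by
  have h1 := mul_sub_le_of_le_hasDerivAt (c := 0) h01 (fun t ht => (hD t ht).sub (hy t ht))
    fun t ht => sub_nonneg.2 ((le_abs_self _).trans (h t ht))
  have h2 := mul_sub_le_of_le_hasDerivAt (c := 0) h01 (fun t ht => (hD t ht).add (hy t ht))
    fun t ht => by linarith [(neg_le_abs _).trans (h t ht)]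
  simp only [Pi.sub_apply, Pi.add_apply] at h1 h2
  rw [abs_le]
  constructor <;> linarith

/-- A quantity chasing, with cubic force and a perturbation, a target that stays `ρ`-close to
`x`. -/
theorem cubic_chase {y φ τ d b b' D D' : ℝ → ℝ} {t₀ t₁ x ρ : ℝ} (h01 : t₀ ≤ t₁)
    (hy : ∀ t ∈ Icc t₀ t₁, HasDerivAt y (φ t * (τ t - y t) ^ 3 + d t) t)
    (hb : ∀ t ∈ Icc t₀ t₁, HasDerivAt b (b' t) t) (hD : ∀ t ∈ Icc t₀ t₁, HasDerivAt D (D' t) t)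
    (hb0 : ∀ t ∈ Icc t₀ t₁, 0 < b t) (hD0 : ∀ t ∈ Icc t₀ t₁, 0 ≤ D t)
    (hφ0 : ∀ t ∈ Icc t₀ t₁, 0 ≤ φ t) (hφ : ∀ t ∈ Icc t₀ t₁, -b' t < φ t * b t ^ 3)
    (hτ : ∀ t ∈ Icc t₀ t₁, |τ t - x| ≤ ρ) (hd : ∀ t ∈ Icc t₀ t₁, |d t| ≤ D' t)
    (h0 : |y t₀ - x| ≤ ρ + b t₀ + D t₀) : |y t₁ - x| ≤ ρ + b t₁ + D t₁ := by
  refine abs_le_of_barrier (y := fun t => y t - x) (b := fun t => ρ + b t + D t) h01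
    (fun t ht => (hy t ht).sub_const x) (fun t ht => ((hb t ht).const_add ρ).add (hD t ht)) h0
    (fun t ht h => ?_) (fun t ht h => ?_)
  all_goals
    obtain ⟨h1, h2⟩ := abs_le.1 (hτ t ht)
    obtain ⟨h3, h4⟩ := abs_le.1 (hd t ht)
    have h5 := hb0 t ht
    have h6 := hD0 t ht
    have h7 := hφ t ht
  · have h8 : b t ^ 3 ≤ (y t - τ t) ^ 3 := pow_le_pow_left₀ h5.le (by linarith) 3
    have h9 := mul_le_mul_of_nonneg_left h8 (hφ0 t ht)
    have h10 : (τ t - y t) ^ 3 = -(y t - τ t) ^ 3 := by ring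
    rw [h10]
    linarith
  · have h8 : b t ^ 3 ≤ (τ t - y t) ^ 3 := pow_le_pow_left₀ h5.le (by linarith) 3
    have h9 := mul_le_mul_of_nonneg_left h8 (hφ0 t ht)
    linarith

theorem cubic_chase_stay {y φ τ d D D' : ℝ → ℝ} {t₀ t₁ x ρ r : ℝ} (h01 : t₀ ≤ t₁)
    (hy : ∀ t ∈ Icc t₀ t₁, HasDerivAt y (φ t * (τ t - y t) ^ 3 + d t) t)
    (hD : ∀ t ∈ Icc t₀ t₁, HasDerivAt D (D' t) t) (hr : 0 < r)
    (hD0 : ∀ t ∈ Icc t₀ t₁, 0 ≤ D t) (hφ : ∀ t ∈ Icc t₀ t₁, 0 < φ t)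
    (hτ : ∀ t ∈ Icc t₀ t₁, |τ t - x| ≤ ρ) (hd : ∀ t ∈ Icc t₀ t₁, |d t| ≤ D' t)
    (h0 : |y t₀ - x| ≤ ρ + r + D t₀) : |y t₁ - x| ≤ ρ + r + D t₁ :=
  cubic_chase (b := fun _ => r) (b' := fun _ => 0) h01 hy (fun t _ => hasDerivAt_const t r) hD
    (fun _ _ => hr) hD0 (fun t ht => (hφ t ht).le)
    (fun t ht => by rw [neg_zero]; exact mul_pos (hφ t ht) (pow_pos hr 3)) hτ hd h0

/-- With a cubic force of strength more than `g`, the target is approached in a time that does not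
depend on the initial distance. -/
theorem cubic_chase_approach {y φ τ d D D' : ℝ → ℝ} {t₀ t₁ x ρ r g : ℝ} (h01 : t₀ ≤ t₁)
    (hy : ∀ t ∈ Icc t₀ t₁, HasDerivAt y (φ t * (τ t - y t) ^ 3 + d t) t)
    (hD : ∀ t ∈ Icc t₀ t₁, HasDerivAt D (D' t) t) (hr : 0 < r) (hg : 0 ≤ g)
    (hgr : 1 ≤ 2 * g * (t₁ - t₀) * r ^ 2)
    (hD0 : ∀ t ∈ Icc t₀ t₁, 0 ≤ D t) (hφ : ∀ t ∈ Icc t₀ t₁, g < φ t)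
    (hτ : ∀ t ∈ Icc t₀ t₁, |τ t - x| ≤ ρ) (hd : ∀ t ∈ Icc t₀ t₁, |d t| ≤ D' t) :
    |y t₁ - x| ≤ ρ + r + D t₁ := by
  have hρ : 0 ≤ ρ := (abs_nonneg _).trans (hτ t₀ ⟨le_rfl, h01⟩)
  set κ : ℝ := 1 / (|y t₀ - x| + 1) ^ 2
  have hκ : 0 < κ := by positivity
  have hh : ∀ t ∈ Icc t₀ t₁, 0 < 2 * g * (t - t₀) + κ := fun t ht => by
    have := mul_nonneg (mul_nonneg zero_le_two hg) (sub_nonneg.2 ht.1)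
    linarith
  have hb : ∀ t ∈ Icc t₀ t₁, HasDerivAt (fun t => (√(2 * g * (t - t₀) + κ))⁻¹)
      (-g * (√(2 * g * (t - t₀) + κ))⁻¹ ^ 3) t := by
    intro t ht
    have h1 : HasDerivAt (fun t => 2 * g * (t - t₀) + κ) (2 * g) t := by
      simpa using (((hasDerivAt_id t).sub_const t₀).const_mul (2 * g)).add_const κ
    have h2 := (h1.sqrt (hh t ht).ne').inv (Real.sqrt_ne_zero'.2 (hh t ht))
    have h3 : -g * (√(2 * g * (t - t₀) + κ))⁻¹ ^ 3 =
        -(2 * g / (2 * √(2 * g * (t - t₀) + κ))) / √(2 * g * (t - t₀) + κ) ^ 2 := by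
      have := Real.sqrt_ne_zero'.2 (hh t ht)
      field_simp
    rw [h3]
    exact h2
  have key := cubic_chase h01 hy hb hD (fun t ht => inv_pos.2 (Real.sqrt_pos.2 (hh t ht))) hD0
    (fun t ht => hg.trans (hφ t ht).le) (fun t ht => by
      rw [neg_mul, neg_neg]
      exact mul_lt_mul_of_pos_right (hφ t ht) (pow_pos (inv_pos.2 (Real.sqrt_pos.2 (hh t ht))) 3))
    hτ hd (by
      have h2 : √κ = 1 / (|y t₀ - x| + 1) := by
        rw [show κ = (1 / (|y t₀ - x| + 1)) ^ 2 by rw [div_pow, one_pow], Real.sqrt_sq (by positivity)]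
      have := hD0 t₀ ⟨le_rfl, h01⟩
      rw [sub_self, mul_zero, zero_add, h2, one_div, inv_inv]
      linarith)
  refine key.trans (by
    gcongr
    rw [inv_le_comm₀ (Real.sqrt_pos.2 (hh t₁ ⟨h01, le_rfl⟩)) hr]
    refine Real.le_sqrt_of_sq_le ?_
    rw [inv_pow, ← one_div, div_le_iff₀ (by positivity)]
    nlinarith [mul_pos hκ (pow_pos hr 2)])

/-- A quantity attracted by the zero `x` of the force `sin (2π(y - x))`, with a perturbation. -/
theorem sine_contraction {y φ d D D' : ℝ → ℝ} {t₀ t₁ g r : ℝ} {x : ℤ} (h01 : t₀ ≤ t₁)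
    (hy : ∀ t ∈ Icc t₀ t₁, HasDerivAt y (-φ t * Real.sin (2 * Real.pi * y t) + d t) t)
    (hD : ∀ t ∈ Icc t₀ t₁, HasDerivAt D (D' t) t) (hD0 : ∀ t ∈ Icc t₀ t₁, 0 ≤ D t)
    (hr : 0 < r) (hg : 0 ≤ g) (hrD : ∀ t ∈ Icc t₀ t₁, r + D t ≤ 1 / 4)
    (hφ : ∀ t ∈ Icc t₀ t₁, g < φ t) (hd : ∀ t ∈ Icc t₀ t₁, |d t| ≤ D' t)
    (h0 : |y t₀ - x| ≤ r + D t₀) :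
    |y t₁ - x| ≤ r * Real.exp (-4 * g * (t₁ - t₀)) + D t₁ := by
  have hb : ∀ t, HasDerivAt (fun t => r * Real.exp (-4 * g * (t - t₀)))
      (r * (Real.exp (-4 * g * (t - t₀)) * (-4 * g))) t := fun t => by
    have h1 : HasDerivAt (fun t => -4 * g * (t - t₀)) (-4 * g) t := by
      simpa using ((hasDerivAt_id t).sub_const t₀).const_mul (-4 * g)
    exact h1.exp.const_mul r
  have hsin : ∀ w : ℝ, 0 ≤ w → w ≤ 1 / 4 → 4 * w ≤ Real.sin (2 * Real.pi * w) := by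
    intro w h1 h2
    have h3 := Real.mul_le_sin (x := 2 * Real.pi * w) (by positivity)
      (by nlinarith [Real.pi_pos])
    have h4 : 2 / Real.pi * (2 * Real.pi * w) = 4 * w := by
      field_simp; ring
    linarith
  have hforce : ∀ t ∈ Icc t₀ t₁, ∀ w, w = r * Real.exp (-4 * g * (t - t₀)) + D t →
      -φ t * Real.sin (2 * Real.pi * w) + D' t <
        r * (Real.exp (-4 * g * (t - t₀)) * (-4 * g)) + D' t := by
    intro t ht w hw
    have hE : 0 < Real.exp (-4 * g * (t - t₀)) := Real.exp_pos _
    have hE1 : Real.exp (-4 * g * (t - t₀)) ≤ 1 := Real.exp_le_one_iff.2 (by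
      have := mul_nonneg hg (sub_nonneg.2 ht.1)
      linarith)
    have h1 : r * Real.exp (-4 * g * (t - t₀)) ≤ r := mul_le_of_le_one_right hr.le hE1
    have h2 := hD0 t ht
    have h2' := hrD t ht
    have h3 := mul_pos hr hE
    have h4 := hsin w (by linarith) (by linarith)
    have h5 : g * (4 * w) < φ t * (4 * w) := mul_lt_mul_of_pos_right (hφ t ht) (by linarith)
    have h6 := mul_le_mul_of_nonneg_left h4 (hg.trans (hφ t ht).le)
    have h7 := mul_nonneg hg h2
    rw [hw] at h5 h6 ⊢
    linarith
  refine abs_le_of_barrier (y := fun t => y t - x)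
    (b := fun t => r * Real.exp (-4 * g * (t - t₀)) + D t) h01
    (fun t ht => (hy t ht).sub_const (x : ℝ)) (fun t ht => (hb t).add (hD t ht)) (by simpa using h0)
    (fun t ht h => ?_) (fun t ht h => ?_)
  · have h1 := hforce t ht _ h
    have h2 : 2 * Real.pi * (y t - x) = 2 * Real.pi * y t - x * (2 * Real.pi) := by ring
    rw [h2, Real.sin_sub_int_mul_two_pi] at h1
    linarith [(abs_le.1 (hd t ht)).2]
  · have h1 := hforce t ht _ h
    have h2 : 2 * Real.pi * -(y t - x) = -(2 * Real.pi * y t - x * (2 * Real.pi)) := by ring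
    rw [h2, Real.sin_neg, Real.sin_sub_int_mul_two_pi] at h1
    linarith [(abs_le.1 (hd t ht)).1]

end

section

open Set

/-! ### The clock -/

/-- The oscillating clock signal of period `1`. -/
noncomputable def clock (t : ℝ) : ℝ := Real.sin (2 * Real.pi * t)

theorem clock_sub_nat (t : ℝ) (n : ℕ) : clock (t - n) = clock t := by
  rw [clock, clock, mul_sub, mul_comm (2 * Real.pi) (n : ℝ), Real.sin_sub_nat_mul_two_pi]

theorem clock_sub_half (t : ℝ) : clock (t - 1 / 2) = -clock t := by
  rw [clock, clock, ← Real.sin_sub_pi]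
  congr 1
  ring

theorem clock_nonneg {n : ℕ} {t : ℝ} (h1 : n ≤ t) (h2 : t ≤ n + 1 / 2) : 0 ≤ clock t := by
  rw [← clock_sub_nat t n]
  exact Real.sin_nonneg_of_nonneg_of_le_pi (mul_nonneg (by positivity) (by linarith))
    (by nlinarith [Real.pi_pos])

theorem clock_nonpos {n : ℕ} {t : ℝ} (h1 : n + 1 / 2 ≤ t) (h2 : t ≤ n + 1) : clock t ≤ 0 := by
  have := clock_nonneg (n := n) (t := t - 1 / 2) (by linarith) (by linarith)
  rw [clock_sub_half] at this
  linarith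

theorem le_clock {n : ℕ} {t : ℝ} (h1 : n + 1 / 8 ≤ t) (h2 : t ≤ n + 3 / 8) :
    7 / 10 ≤ clock t := by
  rw [← clock_sub_nat t n, clock, ← Real.cos_sub_pi_div_two, ← Real.cos_abs]
  have hp := Real.pi_pos
  have h3 : |2 * Real.pi * (t - n) - Real.pi / 2| ≤ Real.pi / 4 := by
    rw [abs_le]; constructor <;> nlinarith
  have h4 := Real.cos_le_cos_of_nonneg_of_le_pi (abs_nonneg _) (by linarith) h3
  rw [Real.cos_pi_div_four] at h4
  have h5 : (14 / 10 : ℝ) ≤ √2 := Real.le_sqrt_of_sq_le (by norm_num)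
  linarith

theorem clock_le {n : ℕ} {t : ℝ} (h1 : n + 5 / 8 ≤ t) (h2 : t ≤ n + 7 / 8) :
    clock t ≤ -(7 / 10) := by
  have := le_clock (n := n) (t := t - 1 / 2) (by linarith) (by linarith)
  rw [clock_sub_half] at this
  linarith

/-! ### Trajectories of the reduced system -/

/-- The gate that is open in the first half of each period. -/
noncomputable def gateA (u : ℝ → ℝ) (t : ℝ) : ℝ := Real.exp (u t * (clock t - 1 / 2))

/-- The gate that is open in the second half of each period. -/
noncomputable def gateB (u : ℝ → ℝ) (t : ℝ) : ℝ := Real.exp (u t * (-clock t - 1 / 2))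

/-- The growth rate of the variable that controls the gates. -/
noncomputable def growth {N : ℕ} (F : (Fin 3 → Fin N → ℝ) → Fin 3 → ℝ) (z : Fin 3 → ℝ → ℝ)
    (v : Fin 3 → Fin N → ℝ → ℝ) (t : ℝ) : ℝ :=
  1 + ∑ i, z i t ^ 2 + ∑ i, (F (fun i a => v i a t) i - z i t) ^ 6 +
    ∑ i, ∑ a : Fin N, (z i t - (a : ℕ) - v i a t) ^ 6

/-- On `[0, T]` the functions `z, v, u` solve the reduced system, in which `z` computes an iteration
of the map approximated by `F`, and `v i a` is a copy of `z i - a`. -/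
structure IsTrajectory {N : ℕ} (F : (Fin 3 → Fin N → ℝ) → Fin 3 → ℝ) (K T : ℝ)
    (z : Fin 3 → ℝ → ℝ) (v : Fin 3 → Fin N → ℝ → ℝ) (u : ℝ → ℝ) : Prop where
  hasDerivAt_z : ∀ t ∈ Icc 0 T, ∀ i, HasDerivAt (z i) (-gateA u t * Real.sin (2 * Real.pi * z i t) +
    gateB u t * (F (fun i a => v i a t) i - z i t) ^ 3) t
  hasDerivAt_v : ∀ t ∈ Icc 0 T, ∀ i a,
    HasDerivAt (v i a) (gateA u t * (z i t - (a : ℕ) - v i a t) ^ 3) t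
  hasDerivAt_u : ∀ t ∈ Icc 0 T, HasDerivAt u (K * growth F z v t) t
  u_zero : u 0 = 0

/-- The bound for the drift, from time `t₀` on, of the variables whose gate is closed. -/
noncomputable def drift (K : ℝ) (u : ℝ → ℝ) (t₀ t : ℝ) : ℝ :=
  2 / K * (Real.exp (-u t₀ / 2) - Real.exp (-u t / 2))

theorem drift_self (K : ℝ) (u : ℝ → ℝ) (t : ℝ) : drift K u t t = 0 := by
  rw [drift, sub_self, mul_zero]

theorem gateA_pos (u : ℝ → ℝ) (t : ℝ) : 0 < gateA u t := Real.exp_pos _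

theorem gateB_pos (u : ℝ → ℝ) (t : ℝ) : 0 < gateB u t := Real.exp_pos _

theorem abs_cube_le (y : ℝ) : |y ^ 3| ≤ 1 + y ^ 6 := by
  rw [abs_le]
  constructor <;> nlinarith [sq_nonneg (y ^ 3 + 1), sq_nonneg (y ^ 3 - 1), sq_nonneg (y ^ 3)]

section growth

variable {N : ℕ} (F : (Fin 3 → Fin N → ℝ) → Fin 3 → ℝ) (z : Fin 3 → ℝ → ℝ)
  (v : Fin 3 → Fin N → ℝ → ℝ) (t : ℝ)

theorem sum_sq_le_growth : 1 + ∑ i, z i t ^ 2 ≤ growth F z v t := by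
  have h2 : 0 ≤ ∑ i, (F (fun i a => v i a t) i - z i t) ^ 6 :=
    Finset.sum_nonneg fun i _ => Even.pow_nonneg (by decide) _
  have h3 : 0 ≤ ∑ i, ∑ a : Fin N, (z i t - (a : ℕ) - v i a t) ^ 6 :=
    Finset.sum_nonneg fun i _ => Finset.sum_nonneg fun a _ => Even.pow_nonneg (by decide) _
  unfold growth
  linarith

theorem one_le_growth : 1 ≤ growth F z v t := by
  have h1 : 0 ≤ ∑ i, z i t ^ 2 := Finset.sum_nonneg fun i _ => sq_nonneg _
  linarith [sum_sq_le_growth F z v t]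

theorem abs_cube_target_le_growth (i : Fin 3) :
    |(F (fun i a => v i a t) i - z i t) ^ 3| ≤ growth F z v t := by
  have h1 : 0 ≤ ∑ i, z i t ^ 2 := Finset.sum_nonneg fun i _ => sq_nonneg _
  have h2 : (F (fun i a => v i a t) i - z i t) ^ 6 ≤ ∑ i, (F (fun i a => v i a t) i - z i t) ^ 6 :=
    Finset.single_le_sum (f := fun i => (F (fun i a => v i a t) i - z i t) ^ 6)
      (fun i _ => Even.pow_nonneg (by decide) _) (Finset.mem_univ i)
  have h3 : 0 ≤ ∑ i, ∑ a : Fin N, (z i t - (a : ℕ) - v i a t) ^ 6 :=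
    Finset.sum_nonneg fun i _ => Finset.sum_nonneg fun a _ => Even.pow_nonneg (by decide) _
  unfold growth
  linarith [abs_cube_le (F (fun i a => v i a t) i - z i t)]

theorem abs_cube_copy_le_growth (i : Fin 3) (a : Fin N) :
    |(z i t - (a : ℕ) - v i a t) ^ 3| ≤ growth F z v t := by
  have h1 : 0 ≤ ∑ i, z i t ^ 2 := Finset.sum_nonneg fun i _ => sq_nonneg _
  have h2 : 0 ≤ ∑ i, (F (fun i a => v i a t) i - z i t) ^ 6 :=
    Finset.sum_nonneg fun i _ => Even.pow_nonneg (by decide) _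
  have h3 : (z i t - (a : ℕ) - v i a t) ^ 6 ≤ ∑ a : Fin N, (z i t - (a : ℕ) - v i a t) ^ 6 :=
    Finset.single_le_sum (f := fun a => (z i t - ((a : Fin N) : ℕ) - v i a t) ^ 6)
      (fun i _ => Even.pow_nonneg (by decide) _) (Finset.mem_univ a)
  have h4 : ∑ a : Fin N, (z i t - (a : ℕ) - v i a t) ^ 6 ≤ ∑ i, ∑ a : Fin N, (z i t - (a : ℕ) - v i a t) ^ 6 :=
    Finset.single_le_sum (f := fun i => ∑ a : Fin N, (z i t - (a : ℕ) - v i a t) ^ 6)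
      (fun i _ => Finset.sum_nonneg fun a _ => Even.pow_nonneg (by decide) _) (Finset.mem_univ i)
  unfold growth
  linarith [abs_cube_le (z i t - (a : ℕ) - v i a t)]

end growth

namespace IsTrajectory

variable {N : ℕ} {F : (Fin 3 → Fin N → ℝ) → Fin 3 → ℝ} {K T : ℝ} {z : Fin 3 → ℝ → ℝ}
  {v : Fin 3 → Fin N → ℝ → ℝ} {u : ℝ → ℝ}

theorem u_mono (h : IsTrajectory F K T z v u) (hK : 0 < K) {t₀ t₁ : ℝ} (h0 : 0 ≤ t₀)
    (h01 : t₀ ≤ t₁) (h1 : t₁ ≤ T) : u t₀ ≤ u t₁ := by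
  have := mul_sub_le_of_le_hasDerivAt (c := 0) h01
    (fun t ht => h.hasDerivAt_u t ⟨h0.trans ht.1, ht.2.trans h1⟩)
    fun t _ => mul_nonneg hK.le (zero_le_one.trans (one_le_growth F z v t))
  linarith

theorem u_nonneg (h : IsTrajectory F K T z v u) (hK : 0 < K) {t : ℝ} (h0 : 0 ≤ t) (h1 : t ≤ T) :
    0 ≤ u t := h.u_zero ▸ h.u_mono hK le_rfl h0 h1

theorem hasDerivAt_drift (h : IsTrajectory F K T z v u) (hK : 0 < K) (t₀ : ℝ) {t : ℝ}
    (ht : t ∈ Icc 0 T) :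
    HasDerivAt (drift K u t₀) (Real.exp (-u t / 2) * growth F z v t) t := by
  have h1 := ((((h.hasDerivAt_u t ht).neg.div_const 2).exp).const_sub
    (Real.exp (-u t₀ / 2))).const_mul (2 / K)
  refine h1.congr_deriv ?_
  have := hK.ne'
  simp only [Pi.neg_apply]
  field_simp

theorem drift_nonneg (h : IsTrajectory F K T z v u) (hK : 0 < K) {t₀ t : ℝ} (h0 : 0 ≤ t₀)
    (h01 : t₀ ≤ t) (h1 : t ≤ T) : 0 ≤ drift K u t₀ t := by
  have := h.u_mono hK h0 h01 h1
  exact mul_nonneg (by positivity) (sub_nonneg.2 (Real.exp_le_exp.2 (by linarith)))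

theorem drift_le {K : ℝ} (hK : 0 < K) {u : ℝ → ℝ} {t₀ t w : ℝ} (hw0 : 0 < w) (hw : w ≤ u t₀) :
    drift K u t₀ t ≤ 4 / (K * w) := by
  have h1 : Real.exp (-u t₀ / 2) ≤ 2 / w := by
    have h2 : Real.exp (-u t₀ / 2) ≤ Real.exp (-(w / 2)) := Real.exp_le_exp.2 (by linarith)
    have h3 : Real.exp (-(w / 2)) ≤ (w / 2)⁻¹ := by
      rw [Real.exp_neg]
      exact inv_anti₀ (by positivity) (by linarith [Real.add_one_le_exp (w / 2)])
    rw [inv_div] at h3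
    linarith
  calc drift K u t₀ t ≤ 2 / K * (2 / w) := by
        unfold drift
        gcongr
        linarith [Real.exp_pos (-u t / 2)]
    _ = 4 / (K * w) := by field_simp; norm_num

theorem drift_le_of_nonneg {K : ℝ} (hK : 0 < K) {u : ℝ → ℝ} {t₀ t : ℝ} (hw : 0 ≤ u t₀) :
    drift K u t₀ t ≤ 2 / K := by
  have h2 : Real.exp (-u t₀ / 2) ≤ 1 := Real.exp_le_one_iff.2 (by linarith)
  have h3 := Real.exp_pos (-u t / 2)
  exact mul_le_of_le_one_right (by positivity) (by linarith)

theorem abs_gateB_mul_le (h : IsTrajectory F K T z v u) (hK : 0 < K) {t : ℝ} (ht : t ∈ Icc 0 T)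
    (hc : 0 ≤ clock t) {y : ℝ} (hy : |y| ≤ growth F z v t) :
    |gateB u t * y| ≤ Real.exp (-u t / 2) * growth F z v t := by
  have hu := h.u_nonneg hK ht.1 ht.2
  rw [abs_mul, abs_of_pos (gateB_pos u t)]
  exact mul_le_mul (Real.exp_le_exp.2 (by nlinarith)) hy (abs_nonneg _) (Real.exp_pos _).le

theorem abs_gateA_mul_le (h : IsTrajectory F K T z v u) (hK : 0 < K) {t : ℝ} (ht : t ∈ Icc 0 T)
    (hc : clock t ≤ 0) {y : ℝ} (hy : |y| ≤ growth F z v t) :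
    |gateA u t * y| ≤ Real.exp (-u t / 2) * growth F z v t := by
  have hu := h.u_nonneg hK ht.1 ht.2
  rw [abs_mul, abs_of_pos (gateA_pos u t)]
  exact mul_le_mul (Real.exp_le_exp.2 (by nlinarith)) hy (abs_nonneg _) (Real.exp_pos _).le

theorem lt_gateA {u : ℝ → ℝ} {t w : ℝ} (hw : 0 ≤ w) (hu : w ≤ u t) (hc : 7 / 10 ≤ clock t) :
    w / 5 < gateA u t := by
  have := Real.add_one_le_exp (u t * (clock t - 1 / 2))
  unfold gateA
  nlinarith

theorem lt_gateB {u : ℝ → ℝ} {t w : ℝ} (hw : 0 ≤ w) (hu : w ≤ u t) (hc : clock t ≤ -(7 / 10)) :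
    w / 5 < gateB u t := by
  have := Real.add_one_le_exp (u t * (-clock t - 1 / 2))
  unfold gateB
  nlinarith

/-! #### One period -/

/-- While gate `A` is open, `z` is attracted by the integers. -/
theorem abs_z_sub_le (h : IsTrajectory F K T z v u) (hK : 0 < K) {n : ℕ} {t₀ t₁ g r : ℝ} {x : ℤ}
    {i : Fin 3} (h0 : n ≤ t₀) (h01 : t₀ ≤ t₁) (h1 : t₁ ≤ n + 1 / 2) (h1T : t₁ ≤ T) (hr : 0 < r)
    (hg : 0 ≤ g) (hrD : ∀ t ∈ Icc t₀ t₁, r + drift K u t₀ t ≤ 1 / 4)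
    (hφ : ∀ t ∈ Icc t₀ t₁, g < gateA u t) (hz : |z i t₀ - x| ≤ r) :
    |z i t₁ - x| ≤ r * Real.exp (-4 * g * (t₁ - t₀)) + drift K u t₀ t₁ := by
  have ht₀ : 0 ≤ t₀ := (Nat.cast_nonneg n).trans h0
  have hmem : ∀ t ∈ Icc t₀ t₁, t ∈ Icc 0 T := fun t ht => ⟨ht₀.trans ht.1, ht.2.trans h1T⟩
  refine sine_contraction h01 (fun t ht => h.hasDerivAt_z t (hmem t ht) i)
    (fun t ht => h.hasDerivAt_drift hK t₀ (hmem t ht))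
    (fun t ht => h.drift_nonneg hK ht₀ ht.1 (ht.2.trans h1T)) hr hg hrD hφ
    (fun t ht => ?_) (by rwa [drift_self, add_zero])
  exact h.abs_gateB_mul_le hK (hmem t ht) (clock_nonneg (h0.trans ht.1) (ht.2.trans h1))
    (abs_cube_target_le_growth F z v t i)

end IsTrajectory

end

section

open Set

theorem sq_one_add_sum_abs_le {z x : Fin 3 → ℝ} (h : ∀ i, |z i - x i| ≤ 1 / 8) :
    (1 + ∑ i, |x i|) ^ 2 / 16 ≤ 1 + ∑ i, z i ^ 2 := by
  have h1 : ∀ i, |x i| ≤ |z i| + 1 / 8 := fun i => by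
    have := abs_sub_abs_le_abs_sub (x i) (z i)
    rw [abs_sub_comm] at this
    linarith [h i]
  have h0 : ∀ i, 0 ≤ |x i| := fun i => abs_nonneg _
  simp only [Fin.sum_univ_three, ← sq_abs (z _)]
  have h2 : (1 + (|x 0| + |x 1| + |x 2|)) ^ 2 ≤ (11 / 8 + (|z 0| + |z 1| + |z 2|)) ^ 2 := by
    refine pow_le_pow_left₀ ?_ ?_ 2
    · linarith [h0 0, h0 1, h0 2]
    · linarith [h1 0, h1 1, h1 2]
  nlinarith [sq_nonneg (|z 0| - |z 1|), sq_nonneg (|z 0| - |z 2|), sq_nonneg (|z 1| - |z 2|),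
    sq_nonneg (|z 0| - 11 / 8), sq_nonneg (|z 1| - 11 / 8), sq_nonneg (|z 2| - 11 / 8)]

namespace IsTrajectory

variable {N : ℕ} {F : (Fin 3 → Fin N → ℝ) → Fin 3 → ℝ} {k K T : ℝ} {z : Fin 3 → ℝ → ℝ}
  {v : Fin 3 → Fin N → ℝ → ℝ} {u : ℝ → ℝ} {n : ℕ} {x x' : Fin 3 → ℤ}

theorem abs_z_sub_le_of_first_half (h : IsTrajectory F K T z v u) (hK : 64 ≤ K) {t : ℝ}
    {i : Fin 3} (hz : |z i n - x i| ≤ 3 / 32) (h0 : n ≤ t) (h1 : t ≤ n + 1 / 2) (hT : t ≤ T) :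
    |z i t - x i| ≤ 1 / 8 := by
  have hK0 : 0 < K := by linarith
  have hd : ∀ s, drift K u n s ≤ 1 / 32 := fun s =>
    (drift_le_of_nonneg hK0 (h.u_nonneg hK0 (Nat.cast_nonneg n) (h0.trans hT))).trans (by
      rw [div_le_iff₀ hK0]; linarith)
  have := h.abs_z_sub_le (g := 0) (r := 3 / 32) hK0 le_rfl h0 h1 hT (by norm_num) le_rfl
    (fun s _ => by linarith [hd s]) (fun s _ => gateA_pos u s) hz
  rw [mul_zero, zero_mul, Real.exp_zero] at this
  linarith [hd t]

theorem le_u (h : IsTrajectory F (k ^ 2) T z v u) (hk : 10000 ≤ k)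
    (hz : ∀ i, |z i n - x i| ≤ 3 / 32) {t : ℝ} (h0 : n + 1 / 8 ≤ t) (hT : t ≤ T) :
    (k * (1 + ∑ i, |(x i : ℝ)|)) ^ 2 / 128 ≤ u t := by
  have hK : 64 ≤ k ^ 2 := by nlinarith
  have hn : (0 : ℝ) ≤ n := Nat.cast_nonneg n
  have h1 := mul_sub_le_of_le_hasDerivAt (c := (k * (1 + ∑ i, |(x i : ℝ)|)) ^ 2 / 16)
    (show (n : ℝ) ≤ n + 1 / 8 by linarith)
    (fun t ht => h.hasDerivAt_u t ⟨hn.trans ht.1, by linarith [ht.2]⟩) (fun t ht => by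
      have h2 := sq_one_add_sum_abs_le (z := fun i => z i t) (x := fun i => (x i : ℝ)) fun i =>
        h.abs_z_sub_le_of_first_half hK (hz i) ht.1 (by linarith [ht.2]) (by linarith [ht.2])
      have h3 := mul_le_mul_of_nonneg_left (h2.trans (sum_sq_le_growth F z v t)) (sq_nonneg k)
      rw [mul_pow]
      linarith)
  have h2 := h.u_nonneg (by linarith) hn (show (n : ℝ) ≤ T by linarith)
  have h3 := h.u_mono (by linarith) (show (0 : ℝ) ≤ n + 1 / 8 by linarith) h0 hT
  linarith

theorem drift_le_inv (h : IsTrajectory F (k ^ 2) T z v u) (hk : 10000 ≤ k)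
    (hz : ∀ i, |z i n - x i| ≤ 3 / 32) {t₀ : ℝ} (h0 : n + 1 / 8 ≤ t₀) (hT : t₀ ≤ T) (t : ℝ) :
    drift (k ^ 2) u t₀ t ≤ 1 / (k * (1 + ∑ i, |(x i : ℝ)|)) := by
  have hw := h.le_u hk hz h0 hT
  have hP : 10000 ≤ k * (1 + ∑ i, |(x i : ℝ)|) := by
    have : 0 ≤ ∑ i, |(x i : ℝ)| := Finset.sum_nonneg fun i _ => abs_nonneg _
    nlinarith
  generalize k * (1 + ∑ i, |(x i : ℝ)|) = P at hP hw ⊢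
  refine (drift_le (by positivity) (by positivity) hw).trans ?_
  rw [div_le_div_iff₀ (by positivity) (by positivity)]
  nlinarith [mul_le_mul hk hk (by norm_num) (by linarith), mul_pos (show 0 < P by linarith) (show 0 < P by linarith)]

theorem abs_z_sub_le_of_second_quarter (h : IsTrajectory F (k ^ 2) T z v u) (hk : 10000 ≤ k)
    (hz : ∀ i, |z i n - x i| ≤ 3 / 32) {t : ℝ} (h0 : n + 1 / 4 ≤ t) (h1 : t ≤ n + 1 / 2)
    (hT : t ≤ T) (i : Fin 3) : |z i t - x i| ≤ 3 / (k * (1 + ∑ i, |(x i : ℝ)|)) := by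
  have hK : 64 ≤ k ^ 2 := by nlinarith
  have hK0 : 0 < k ^ 2 := by linarith
  have hd := fun (t₀ : ℝ) (h0 : n + 1 / 8 ≤ t₀) (h1 : t₀ ≤ T) => h.drift_le_inv hk hz h0 h1
  have hu := fun (t : ℝ) (h0 : n + 1 / 8 ≤ t) (h1 : t ≤ T) => h.le_u hk hz h0 h1
  have hP : 10000 ≤ k * (1 + ∑ i, |(x i : ℝ)|) := by
    have : 0 ≤ ∑ i, |(x i : ℝ)| := Finset.sum_nonneg fun i _ => abs_nonneg _
    nlinarith
  generalize k * (1 + ∑ i, |(x i : ℝ)|) = P at hP hd hu ⊢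
  have hP0 : 0 < P := by linarith
  have hPi : 1 / P ≤ 1 / 10000 := by gcongr
  have e1 := h.abs_z_sub_le (g := P ^ 2 / 1000) (r := 1 / 8) (t₀ := n + 1 / 8) (t₁ := n + 1 / 4)
    (n := n) hK0 (by linarith) (by linarith) (by linarith) (by linarith) (by norm_num) (by positivity)
    (fun s _ => by linarith [hd (n + 1 / 8) le_rfl (by linarith) s])
    (fun s hs => lt_of_le_of_lt (by nlinarith)
      (lt_gateA (by positivity) (hu s hs.1 (by linarith [hs.2]))
        (le_clock hs.1 (by linarith [hs.2]))))
    (h.abs_z_sub_le_of_first_half hK (hz i) (by linarith) (by linarith) (by linarith))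
  have e2 : 1 / 8 * Real.exp (-4 * (P ^ 2 / 1000) * (n + 1 / 4 - (n + 1 / 8))) ≤ 1 / P := by
    have h2 : -4 * (P ^ 2 / 1000) * (n + 1 / 4 - (n + 1 / 8)) = -(P ^ 2 / 2000) := by ring
    have h3 : Real.exp (-(P ^ 2 / 2000)) ≤ (P ^ 2 / 2000)⁻¹ := by
      rw [Real.exp_neg]
      exact inv_anti₀ (by positivity) (by linarith [Real.add_one_le_exp (P ^ 2 / 2000)])
    have h4 : (P ^ 2 / 2000)⁻¹ ≤ 1 / P := by
      rw [inv_div, div_le_div_iff₀ (by positivity) hP0]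
      nlinarith
    rw [h2]
    linarith [Real.exp_pos (-(P ^ 2 / 2000))]
  have e3 := hd (n + 1 / 8) le_rfl (by linarith) (n + 1 / 4)
  have e4 := fun s => hd (n + 1 / 4) (by linarith) (by linarith) s
  have e5 := h.abs_z_sub_le (g := 0) (r := 2 / P) (t₀ := n + 1 / 4) (t₁ := t) (x := x i) (i := i)
    (n := n) hK0 (by linarith) h0 h1 hT (by positivity) le_rfl
    (fun s _ => by linarith [e4 s, show 2 / P = 1 / P + 1 / P by ring])
    (fun s _ => gateA_pos u s) (by linarith [show 2 / P = 1 / P + 1 / P by ring])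
  rw [mul_zero, zero_mul, Real.exp_zero, mul_one] at e5
  linarith [e4 t, show 3 / P = 2 / P + 1 / P by ring]

theorem abs_v_sub_le (h : IsTrajectory F (k ^ 2) T z v u) (hk : 10000 ≤ k)
    (hz : ∀ i, |z i n - x i| ≤ 3 / 32) {t : ℝ} (h0 : n + 1 / 2 ≤ t) (h1 : t ≤ n + 1)
    (hT : t ≤ T) (i : Fin 3) (a : Fin N) :
    |v i a t - (x i - (a : ℕ))| ≤ 100 / (k * (1 + ∑ i, |(x i : ℝ)|)) := by
  have hK : 64 ≤ k ^ 2 := by nlinarith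
  have hK0 : 0 < k ^ 2 := by linarith
  have hd := fun (t₀ : ℝ) (h0 : n + 1 / 8 ≤ t₀) (h1 : t₀ ≤ T) => h.drift_le_inv hk hz h0 h1
  have hu := fun (t : ℝ) (h0 : n + 1 / 8 ≤ t) (h1 : t ≤ T) => h.le_u hk hz h0 h1
  have hzs := fun (t : ℝ) (h0 : n + 1 / 4 ≤ t) (h1 : t ≤ n + 1 / 2) (hT : t ≤ T) =>
    h.abs_z_sub_le_of_second_quarter hk hz h0 h1 hT i
  have hP : 10000 ≤ k * (1 + ∑ i, |(x i : ℝ)|) := by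
    have : 0 ≤ ∑ i, |(x i : ℝ)| := Finset.sum_nonneg fun i _ => abs_nonneg _
    nlinarith
  generalize k * (1 + ∑ i, |(x i : ℝ)|) = P at hP hd hu hzs ⊢
  have hP0 : 0 < P := by linarith
  have hn : (0 : ℝ) ≤ n := Nat.cast_nonneg n
  have hv : ∀ t ∈ Icc 0 T,
      HasDerivAt (v i a) (gateA u t * (z i t - (a : ℕ) - v i a t) ^ 3 + 0) t :=
    fun t ht => by simpa using h.hasDerivAt_v t ht i a
  have hτ : ∀ s, |z i s - x i| ≤ 3 / P → |z i s - (a : ℕ) - (x i - (a : ℕ))| ≤ 3 / P :=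
    fun s hs => by rwa [sub_sub_sub_cancel_right]
  have e1 := cubic_chase_approach (D := fun _ => 0) (D' := fun _ => 0) (t₀ := n + 1 / 4)
    (t₁ := n + 3 / 8) (r := 64 / P) (g := P ^ 2 / 1000) (by linarith)
    (fun s hs => hv s ⟨by linarith [hs.1], by linarith [hs.2]⟩)
    (fun s _ => hasDerivAt_const s 0) (by positivity) (by positivity)
    (by field_simp; linarith) (fun _ _ => le_rfl)
    (fun s hs => lt_of_le_of_lt (by nlinarith)
      (lt_gateA (by positivity) (hu s (by linarith [hs.1]) (by linarith [hs.2]))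
        (le_clock (by linarith [hs.1]) hs.2)))
    (fun s hs => hτ s (hzs s hs.1 (by linarith [hs.2]) (by linarith [hs.2])))
    (fun _ _ => by simp)
  have e2 := cubic_chase_stay (D := fun _ => 0) (D' := fun _ => 0) (t₀ := n + 3 / 8)
    (t₁ := n + 1 / 2) (r := 64 / P) (by linarith)
    (fun s hs => hv s ⟨by linarith [hs.1], by linarith [hs.2]⟩)
    (fun s _ => hasDerivAt_const s 0) (by positivity) (fun _ _ => le_rfl)
    (fun s hs => gateA_pos u s)
    (fun s hs => hτ s (hzs s (by linarith [hs.1]) hs.2 (by linarith [hs.2])))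
    (fun _ _ => by simp) e1
  have e3 := abs_sub_le_of_abs_deriv_le h0
    (fun s hs => h.hasDerivAt_v s ⟨by linarith [hs.1], by linarith [hs.2]⟩ i a)
    (fun s hs => h.hasDerivAt_drift hK0 (n + 1 / 2) ⟨by linarith [hs.1], by linarith [hs.2]⟩)
    (fun s hs => h.abs_gateA_mul_le hK0 ⟨by linarith [hs.1], by linarith [hs.2]⟩
      (clock_nonpos hs.1 (by linarith [hs.2])) (abs_cube_copy_le_growth F z v s i a))
  rw [drift_self, sub_zero] at e3
  have e4 := hd (n + 1 / 2) (by linarith) (by linarith) t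
  have e5 := abs_sub_le (v i a t) (v i a (n + 1 / 2)) (x i - (a : ℕ))
  have e6 : 100 / P = 3 / P + 64 / P + 1 / P + 32 / P := by ring
  have e7 : 0 < 32 / P := by positivity
  linarith

theorem abs_z_sub_le_of_second_half (h : IsTrajectory F (k ^ 2) T z v u) (hk : 10000 ≤ k)
    (hz : ∀ i, |z i n - x i| ≤ 3 / 32)
    (hF : ∀ w : Fin 3 → Fin N → ℝ,
      (∀ i a, |w i a - (x i - (a : ℕ))| ≤ 100 / (k * (1 + ∑ i, |(x i : ℝ)|))) →
        ∀ i, |F w i - x' i| ≤ 1 / 64)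
    {t : ℝ} (h0 : n + 1 / 2 ≤ t) (h1 : t ≤ n + 1) (hT : t ≤ T) (i : Fin 3) :
    |z i t - x' i| ≤ |(x i - x' i : ℝ)| + 1 ∧ (t = n + 1 → |z i t - x' i| ≤ 3 / 32) := by
  have hK : 64 ≤ k ^ 2 := by nlinarith
  have hK0 : 0 < k ^ 2 := by linarith
  have hn : (0 : ℝ) ≤ n := Nat.cast_nonneg n
  have hmem : ∀ s : ℝ, n + 1 / 2 ≤ s → s ≤ t → s ∈ Icc 0 T := fun s h2 h3 =>
    ⟨by linarith, h3.trans hT⟩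
  have hd : ∀ t₀ : ℝ, 0 ≤ t₀ → t₀ ≤ T → ∀ s, drift (k ^ 2) u t₀ s ≤ 1 / 32 := fun t₀ h0 h1 s =>
    (drift_le_of_nonneg hK0 (h.u_nonneg hK0 h0 h1)).trans (by
      rw [div_le_iff₀ hK0]; nlinarith)
  have hd' : ∀ t₀, 0 ≤ t₀ → t₀ ≤ T → ∀ s, drift (k ^ 2) u t₀ s ≤ 1 / 64 := fun t₀ h0 h1 s =>
    (drift_le_of_nonneg hK0 (h.u_nonneg hK0 h0 h1)).trans (by
      rw [div_le_iff₀ hK0]; nlinarith)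
  have hy : ∀ s ∈ Icc 0 T, HasDerivAt (z i) (gateB u s * (F (fun i a => v i a s) i - z i s) ^ 3 +
      -(gateA u s * Real.sin (2 * Real.pi * z i s))) s := fun s hs =>
    (h.hasDerivAt_z s hs i).congr_deriv (by ring)
  have hτ : ∀ s : ℝ, n + 1 / 2 ≤ s → s ≤ t → |F (fun i a => v i a s) i - x' i| ≤ 1 / 64 :=
    fun s h2 h3 => hF _ (fun i a => h.abs_v_sub_le hk hz h2 (h3.trans h1) (h3.trans hT) i a) i
  have hdr : ∀ s : ℝ, n + 1 / 2 ≤ s → s ≤ t → |-(gateA u s * Real.sin (2 * Real.pi * z i s))| ≤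
      Real.exp (-u s / 2) * growth F z v s := fun s h2 h3 => by
    rw [abs_neg]
    exact h.abs_gateA_mul_le hK0 (hmem s h2 h3) (clock_nonpos h2 (h3.trans h1))
      ((Real.abs_sin_le_one _).trans (one_le_growth F z v s))
  have stay : ∀ t₀ r : ℝ, n + 1 / 2 ≤ t₀ → t₀ ≤ t → 0 < r → |z i t₀ - x' i| ≤ 1 / 64 + r →
      |z i t - x' i| ≤ 1 / 64 + r + 1 / 64 := by
    intro t₀ r h2 h3 hr h4
    have := cubic_chase_stay h3 (fun s hs => hy s (hmem s (h2.trans hs.1) hs.2))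
      (fun s hs => h.hasDerivAt_drift hK0 t₀ (hmem s (h2.trans hs.1) hs.2)) hr
      (fun s hs => h.drift_nonneg hK0 (by linarith) hs.1 (hs.2.trans hT))
      (fun s _ => gateB_pos u s) (fun s hs => hτ s (h2.trans hs.1) hs.2)
      (fun s hs => hdr s (h2.trans hs.1) hs.2) (by rwa [drift_self, add_zero])
    exact this.trans (add_le_add_right (hd' t₀ (by linarith) (h3.trans hT) t) _)
  constructor
  · have h2 := h.abs_z_sub_le_of_first_half hK (hz i) (show (n : ℝ) ≤ n + 1 / 2 by linarith) le_rfl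
      (h0.trans hT)
    have h3 := stay (n + 1 / 2) (|(x i - x' i : ℝ)| + 1 / 8) le_rfl h0
      (by positivity) (by linarith [abs_sub_le (z i (n + 1 / 2)) (x i) (x' i)])
    linarith
  · intro ht
    have hP : 10000 ≤ k * (1 + ∑ i, |(x i : ℝ)|) := by
      have : 0 ≤ ∑ i, |(x i : ℝ)| := Finset.sum_nonneg fun i _ => abs_nonneg _
      nlinarith
    have hu := fun (t : ℝ) (h0 : n + 1 / 8 ≤ t) (h1 : t ≤ T) => h.le_u hk hz h0 h1
    have e1 := cubic_chase_approach (t₀ := n + 5 / 8) (t₁ := n + 7 / 8) (r := 1 / 64) (g := 100000)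
      (by linarith) (fun s hs => hy s (hmem s (by linarith [hs.1]) (by linarith [hs.2])))
      (fun s hs => h.hasDerivAt_drift hK0 (n + 5 / 8)
        (hmem s (by linarith [hs.1]) (by linarith [hs.2])))
      (by norm_num) (by norm_num) (by norm_num)
      (fun s hs => h.drift_nonneg hK0 (by linarith) hs.1 (by linarith [hs.2]))
      (fun s hs => lt_of_le_of_lt (by nlinarith)
        (lt_gateB (by positivity) (hu s (by linarith [hs.1]) (by linarith [hs.2]))
          (clock_le hs.1 hs.2)))
      (fun s hs => hτ s (by linarith [hs.1]) (by linarith [hs.2]))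
      (fun s hs => hdr s (by linarith [hs.1]) (by linarith [hs.2]))
    have e2 := hd' (n + 5 / 8) (by linarith) (by linarith) (n + 7 / 8)
    have e3 := stay (n + 7 / 8) (1 / 32) (by linarith) (by linarith) (by norm_num) (by linarith)
    linarith

/-- A trajectory that starts at an integer point `x 0` follows the sequence `x` of integer points,
provided that `F` approximates each step of the sequence well enough. -/
theorem abs_z_nat_sub_le (h : IsTrajectory F (k ^ 2) T z v u) (hk : 10000 ≤ k)
    {x : ℕ → Fin 3 → ℤ} (hz : ∀ i, z i 0 = x 0 i)
    (hF : ∀ n, ∀ w : Fin 3 → Fin N → ℝ,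
      (∀ i a, |w i a - (x n i - (a : ℕ))| ≤ 100 / (k * (1 + ∑ i, |(x n i : ℝ)|))) →
        ∀ i, |F w i - x (n + 1) i| ≤ 1 / 64) (n : ℕ) (hn : n ≤ T) (i : Fin 3) :
    |z i n - x n i| ≤ 3 / 32 := by
  induction n generalizing i with
  | zero => norm_num [hz]
  | succ n ih =>
    push_cast at hn ⊢
    exact (h.abs_z_sub_le_of_second_half hk (ih (by linarith)) (hF n) (by linarith) le_rfl hn i).2 rfl

end IsTrajectory

end

section

open Set

namespace IsTrajectory

variable {N : ℕ} {F : (Fin 3 → Fin N → ℝ) → Fin 3 → ℝ} {k T : ℝ}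

theorem mono {K : ℝ} {z : Fin 3 → ℝ → ℝ} {v : Fin 3 → Fin N → ℝ → ℝ} {u : ℝ → ℝ}
    (h : IsTrajectory F K T z v u) {s : ℝ} (hs : s ≤ T) : IsTrajectory F K s z v u :=
  ⟨fun t ht => h.hasDerivAt_z t ⟨ht.1, ht.2.trans hs⟩,
    fun t ht => h.hasDerivAt_v t ⟨ht.1, ht.2.trans hs⟩,
    fun t ht => h.hasDerivAt_u t ⟨ht.1, ht.2.trans hs⟩, h.u_zero⟩

/-- A priori bounds for the trajectories that start at an integer point. -/
theorem exists_bound (hk : 10000 ≤ k) (hFc : Continuous F) {x : ℕ → Fin 3 → ℤ}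
    (hF : ∀ n, ∀ w : Fin 3 → Fin N → ℝ,
      (∀ i a, |w i a - (x n i - (a : ℕ))| ≤ 100 / (k * (1 + ∑ i, |(x n i : ℝ)|))) →
        ∀ i, |F w i - x (n + 1) i| ≤ 1 / 64) (T : ℝ) :
    ∃ R, ∀ t ∈ Icc 0 T, ∀ (z : Fin 3 → ℝ → ℝ) (v : Fin 3 → Fin N → ℝ → ℝ) (u : ℝ → ℝ),
      IsTrajectory F (k ^ 2) t z v u → (∀ i, z i 0 = x 0 i) → (∀ i a, v i a 0 = 0) →
        (∀ i, |z i t| ≤ R) ∧ (∀ i a, |v i a t| ≤ R) ∧ |u t| ≤ R := by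
  set S : ℝ := ∑ n ∈ Finset.range (⌊T⌋₊ + 2), ∑ i, |(x n i : ℝ)|
  have hS : ∀ n ≤ ⌊T⌋₊ + 1, ∀ i, |(x n i : ℝ)| ≤ S := fun n hn i =>
    (Finset.single_le_sum (f := fun i => |(x n i : ℝ)|) (fun _ _ => abs_nonneg _)
      (Finset.mem_univ i)).trans
      (Finset.single_le_sum (f := fun n => ∑ i, |(x n i : ℝ)|)
        (fun _ _ => Finset.sum_nonneg fun _ _ => abs_nonneg _) (by simp; omega))
  have hS0 : 0 ≤ S := Finset.sum_nonneg fun _ _ => Finset.sum_nonneg fun _ _ => abs_nonneg _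
  set M : ℝ := 3 * S + 1
  have hM : 1 ≤ M := by simp only [M]; linarith
  have hzM : ∀ t ∈ Icc 0 T, ∀ (z : Fin 3 → ℝ → ℝ) (v : Fin 3 → Fin N → ℝ → ℝ) (u : ℝ → ℝ),
      IsTrajectory F (k ^ 2) t z v u → (∀ i, z i 0 = x 0 i) → ∀ i, |z i t| ≤ M := by
    intro t ht z v u h hz i
    have h1 : (⌊t⌋₊ : ℝ) ≤ t := Nat.floor_le ht.1
    have h2 : t < ⌊t⌋₊ + 1 := Nat.lt_floor_add_one t
    have h3 : ⌊t⌋₊ ≤ ⌊T⌋₊ := Nat.floor_mono ht.2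
    have h4 := h.abs_z_nat_sub_le hk hz hF ⌊t⌋₊ h1
    have h5 := hS ⌊t⌋₊ (by omega) i
    have h6 := hS (⌊t⌋₊ + 1) (by omega) i
    rcases le_total t (⌊t⌋₊ + 1 / 2) with h7 | h7
    · have h8 := h.abs_z_sub_le_of_first_half (by nlinarith) (h4 i) h1 h7 le_rfl
      have h9 := abs_sub_abs_le_abs_sub (z i t) (x ⌊t⌋₊ i)
      simp only [M]
      linarith
    · have h8 := (h.abs_z_sub_le_of_second_half hk h4 (hF _) h7 h2.le le_rfl i).1
      have h9 := abs_sub_abs_le_abs_sub (z i t) (x (⌊t⌋₊ + 1) i)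
      have h10 := abs_sub (x ⌊t⌋₊ i : ℝ) (x (⌊t⌋₊ + 1) i)
      simp only [M]
      linarith
  set V : ℝ := M + N + 1
  have hV0 : 0 ≤ V := by positivity
  have hvV : ∀ t ∈ Icc 0 T, ∀ (z : Fin 3 → ℝ → ℝ) (v : Fin 3 → Fin N → ℝ → ℝ) (u : ℝ → ℝ),
      IsTrajectory F (k ^ 2) t z v u → (∀ i, z i 0 = x 0 i) → (∀ i a, v i a 0 = 0) →
        ∀ i a, |v i a t| ≤ V := by
    intro t ht z v u h hz hv i a
    have := cubic_chase_stay (x := 0) (ρ := M + N) (r := 1) (D := fun _ => 0) (D' := fun _ => 0)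
      (d := fun _ => 0) (τ := fun s => z i s - (a : ℕ)) ht.1
      (fun s hs => by simpa using h.hasDerivAt_v s hs i a)
      (fun s _ => hasDerivAt_const s 0) one_pos (fun _ _ => le_rfl)
      (fun s hs => gateA_pos u s) (fun s hs => by
        have h1 := hzM s ⟨hs.1, hs.2.trans ht.2⟩ z v u (h.mono hs.2) hz i
        have h2 : ((a : ℕ) : ℝ) ≤ N := by exact_mod_cast a.2.le
        have h3 := abs_sub (z i s) ((a : ℕ) : ℝ)
        rw [Nat.abs_cast] at h3
        rw [sub_zero]
        linarith) (fun _ _ => by simp) (by rw [hv]; simp; positivity)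
    simpa [V] using this
  obtain ⟨B, hB⟩ := (isCompact_closedBall (0 : Fin 3 → Fin N → ℝ) V).exists_bound_of_continuousOn
    hFc.continuousOn
  set Γ : ℝ := 1 + ∑ _i : Fin 3, M ^ 2 + ∑ _i : Fin 3, (B + M) ^ 6 +
    ∑ _i : Fin 3, ∑ _a : Fin N, (M + N + V) ^ 6
  have hΓ : ∀ t ∈ Icc 0 T, ∀ (z : Fin 3 → ℝ → ℝ) (v : Fin 3 → Fin N → ℝ → ℝ) (u : ℝ → ℝ),
      IsTrajectory F (k ^ 2) t z v u → (∀ i, z i 0 = x 0 i) → (∀ i a, v i a 0 = 0) →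
        growth F z v t ≤ Γ := by
    intro t ht z v u h hz hv
    have hz' := hzM t ht z v u h hz
    have hv' := hvV t ht z v u h hz hv
    have hpow : ∀ {a b : ℝ} {m : ℕ}, Even m → |a| ≤ b → a ^ m ≤ b ^ m := fun {a b m} hm hab => by
      rw [← hm.pow_abs]; exact pow_le_pow_left₀ (abs_nonneg _) hab m
    have hFB : ∀ i, |F (fun i a => v i a t) i| ≤ B := fun i =>
      (norm_le_pi_norm (F fun i a => v i a t) i).trans (hB _ (by
        rw [mem_closedBall_zero_iff, pi_norm_le_iff_of_nonneg hV0]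
        intro i
        rw [pi_norm_le_iff_of_nonneg hV0]
        exact hv' i))
    unfold growth
    refine add_le_add (add_le_add (add_le_add le_rfl ?_) ?_) ?_
    · exact Finset.sum_le_sum fun i _ => hpow (by decide) (hz' i)
    · exact Finset.sum_le_sum fun i _ => hpow (by decide)
        ((abs_sub _ _).trans (add_le_add (hFB i) (hz' i)))
    · refine Finset.sum_le_sum fun i _ => Finset.sum_le_sum fun a _ => hpow (by decide)
        ((abs_sub _ _).trans (add_le_add ((abs_sub _ _).trans (add_le_add (hz' i) ?_)) (hv' i a)))
      rw [Nat.abs_cast]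
      exact_mod_cast a.2.le
  refine ⟨M + V + |k ^ 2 * Γ * T|, fun t ht z v u h hz hv => ⟨fun i => ?_, fun i a => ?_, ?_⟩⟩
  · linarith [hzM t ht z v u h hz i, abs_nonneg (k ^ 2 * Γ * T)]
  · linarith [hvV t ht z v u h hz hv i a, abs_nonneg (k ^ 2 * Γ * T)]
  · have hK : 0 < k ^ 2 := by nlinarith
    rw [abs_of_nonneg (h.u_nonneg hK ht.1 le_rfl)]
    have h1 := mul_sub_le_of_le_hasDerivAt (c := -(k ^ 2 * Γ)) ht.1
      (fun s hs => (h.hasDerivAt_u s hs).neg) (fun s hs => neg_le_neg (mul_le_mul_of_nonneg_left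
        (hΓ s ⟨hs.1, hs.2.trans ht.2⟩ z v u (h.mono hs.2) hz hv) hK.le))
    have h2 : 0 ≤ Γ := zero_le_one.trans ((one_le_growth F z v t).trans (hΓ t ht z v u h hz hv))
    have h3 : k ^ 2 * Γ * t ≤ k ^ 2 * Γ * T := mul_le_mul_of_nonneg_left ht.2 (by positivity)
    simp only [Pi.neg_apply, h.u_zero] at h1
    linarith [le_abs_self (k ^ 2 * Γ * T)]

end IsTrajectory

/-! ### Indicator functions of residue classes and piecewise affine maps -/

/-- A trigonometric polynomial that is, on the integers, the indicator function of `Nℤ`. -/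
noncomputable def divisibilityWave (N : ℕ) (y : ℝ) : ℝ :=
  1 / N * ∑ n ∈ Finset.range N, Real.cos (n * (2 * Real.pi / N * y))

theorem divisibilityWave_intCast {N : ℕ} (hN : 0 < N) (y : ℤ) :
    divisibilityWave N y = if (N : ℤ) ∣ y then 1 else 0 := by
  have hN' : (N : ℝ) ≠ 0 := by positivity
  unfold divisibilityWave
  split_ifs with h
  · obtain ⟨c, rfl⟩ := h
    have : ∀ n ∈ Finset.range N, Real.cos (n * (2 * Real.pi / N * ((N * c : ℤ) : ℝ))) = 1 := by
      intro n _
      have : (n : ℝ) * (2 * Real.pi / N * ((N * c : ℤ) : ℝ)) = ((n * c : ℤ) : ℝ) * (2 * Real.pi) := by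
        push_cast
        field_simp
      rw [this, Real.cos_int_mul_two_pi]
    rw [Finset.sum_congr rfl this]
    simp [hN']
  · have hζ : Complex.exp ((2 * Real.pi / N * y : ℝ) * Complex.I) ≠ 1 := by
      rw [Ne, Complex.exp_eq_one_iff]
      rintro ⟨m, hm⟩
      apply h
      have h1 : ((2 * Real.pi / N * y : ℝ) : ℂ) = ((m * (2 * Real.pi) : ℝ) : ℂ) := by
        apply mul_right_cancel₀ Complex.I_ne_zero
        rw [hm]; push_cast; ring
      have h2 := Complex.ofReal_injective h1
      have hpi := Real.pi_pos.ne'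
      field_simp at h2
      exact ⟨m, by exact_mod_cast h2⟩
    have hsum : ∑ n ∈ Finset.range N, Complex.exp ((2 * Real.pi / N * y : ℝ) * Complex.I) ^ n = 0 := by
      rw [geom_sum_eq hζ, ← Complex.exp_nat_mul]
      have : (N : ℂ) * ((2 * Real.pi / N * y : ℝ) * Complex.I) = y * (2 * Real.pi * Complex.I) := by
        have : (N : ℂ) ≠ 0 := by exact_mod_cast hN.ne'
        push_cast
        field_simp
      rw [this, Complex.exp_int_mul_two_pi_mul_I, sub_self, zero_div]
    have hre := congrArg Complex.re hsum
    rw [Complex.re_sum, Complex.zero_re] at hre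
    rw [mul_eq_zero]
    right
    rw [← hre]
    refine Finset.sum_congr rfl fun n _ => ?_
    rw [← Complex.exp_nat_mul, ← Complex.exp_ofReal_mul_I_re]
    push_cast
    ring_nf

theorem abs_divisibilityWave_le_one (N : ℕ) (y : ℝ) : |divisibilityWave N y| ≤ 1 := by
  rcases Nat.eq_zero_or_pos N with rfl | hN
  · simp [divisibilityWave]
  · unfold divisibilityWave
    rw [abs_mul, abs_of_pos (by positivity), one_div, inv_mul_le_iff₀ (by positivity), mul_one]
    refine (Finset.abs_sum_le_sum_abs _ _).trans ((Finset.sum_le_sum fun n _ =>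
      Real.abs_cos_le_one _).trans (by simp))

theorem abs_divisibilityWave_sub_le (N : ℕ) (y y' : ℝ) :
    |divisibilityWave N y - divisibilityWave N y'| ≤ 8 * |y - y'| := by
  rcases Nat.eq_zero_or_pos N with rfl | hN
  · simp [divisibilityWave]
  · unfold divisibilityWave
    have hN' : (0 : ℝ) < N := by positivity
    rw [← mul_sub, ← Finset.sum_sub_distrib, abs_mul, abs_of_pos (by positivity), one_div,
      inv_mul_le_iff₀ hN']
    refine (Finset.abs_sum_le_sum_abs _ _).trans ((Finset.sum_le_card_nsmul _ _
      (8 * |y - y'|) fun n hn => ?_).trans (by simp))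
    have hnN : (n : ℝ) ≤ N := by exact_mod_cast (Finset.mem_range.1 hn).le
    refine (Real.abs_cos_sub_cos_le _ _).trans ?_
    rw [← mul_sub, ← mul_sub, abs_mul, abs_mul, ← mul_assoc]
    refine mul_le_mul_of_nonneg_right ?_ (abs_nonneg _)
    rw [Nat.abs_cast, abs_of_pos (by positivity), mul_div_assoc', div_le_iff₀ hN']
    nlinarith [Real.pi_pos, Real.pi_lt_four]

theorem continuous_divisibilityWave (N : ℕ) : Continuous (divisibilityWave N) := by
  unfold divisibilityWave
  fun_prop

/-- The continuous extension, to copies `w i a` of `y i - a`, of the map that is affine on each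
residue class of `y` modulo `N`, with coefficients `α` and `β`. -/
noncomputable def residueMap {N : ℕ} [NeZero N] (α : (Fin 3 → Fin N) → Fin 3 → Fin 3 → ℚ)
    (β : (Fin 3 → Fin N) → Fin 3 → ℚ) (w : Fin 3 → Fin N → ℝ) (i : Fin 3) : ℝ :=
  ∑ ρ, (∏ l, divisibilityWave N (w l (ρ l))) * (∑ j, (α ρ i j : ℝ) * w j 0 + β ρ i)

theorem continuous_residueMap {N : ℕ} [NeZero N] (α : (Fin 3 → Fin N) → Fin 3 → Fin 3 → ℚ)
    (β : (Fin 3 → Fin N) → Fin 3 → ℚ) : Continuous (residueMap α β) := by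
  have := continuous_divisibilityWave N
  unfold residueMap
  fun_prop

theorem abs_prod_three_sub_le {a b : Fin 3 → ℝ} {η : ℝ} (ha : ∀ i, |a i| ≤ 1) (hb : ∀ i, |b i| ≤ 1)
    (h : ∀ i, |a i - b i| ≤ η) : |∏ i, a i - ∏ i, b i| ≤ 3 * η := by
  have hη : 0 ≤ η := (abs_nonneg _).trans (h 0)
  have h1 : ∏ i, a i - ∏ i, b i =
      (a 0 - b 0) * (a 1 * a 2) + b 0 * ((a 1 - b 1) * a 2) + b 0 * (b 1 * (a 2 - b 2)) := by
    simp only [Fin.prod_univ_three]; ring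
  rw [h1]
  refine (abs_add_three _ _ _).trans ?_
  simp only [abs_mul]
  have h2 : |a 0 - b 0| * (|a 1| * |a 2|) ≤ η * (1 * 1) := by gcongr <;> simp only [h, ha]
  have h3 : |b 0| * (|a 1 - b 1| * |a 2|) ≤ 1 * (η * 1) := by gcongr <;> simp only [h, ha, hb]
  have h4 : |b 0| * (|b 1| * |a 2 - b 2|) ≤ 1 * (1 * η) := by gcongr <;> simp only [h, hb]
  linarith

theorem residueMap_of_forall_dvd {N : ℕ} [NeZero N] (α : (Fin 3 → Fin N) → Fin 3 → Fin 3 → ℚ)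
    (β : (Fin 3 → Fin N) → Fin 3 → ℚ) {x : Fin 3 → ℤ} {ρ : Fin 3 → Fin N}
    (hρ : ∀ l, (N : ℤ) ∣ x l - (ρ l : ℕ)) (i : Fin 3) :
    residueMap α β (fun j a => x j - (a : ℕ)) i = ∑ j, (α ρ i j : ℝ) * x j + β ρ i := by
  have hwave : ∀ ρ' : Fin 3 → Fin N, ∏ l, divisibilityWave N ((x l : ℝ) - ((ρ' l : ℕ) : ℝ)) =
      if ρ' = ρ then 1 else 0 := by
    intro ρ'
    have h1 : ∀ l, divisibilityWave N ((x l : ℝ) - ((ρ' l : ℕ) : ℝ)) = if ρ' l = ρ l then 1 else 0 := by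
      intro l
      have := divisibilityWave_intCast (NeZero.pos N) (x l - (ρ' l : ℕ))
      push_cast at this
      rw [this]
      refine if_congr ⟨fun h => ?_, fun h => h ▸ hρ l⟩ rfl rfl
      have h2 : (N : ℤ) ∣ (ρ' l : ℕ) - (ρ l : ℕ) := by simpa using dvd_sub (hρ l) h
      have h3 := Int.eq_zero_of_abs_lt_dvd h2 (by
        have := (ρ' l).2
        have := (ρ l).2
        rw [abs_lt]; omega)
      exact Fin.ext (by omega)
    simp only [h1]
    split_ifs with h
    · simp [h]
    · obtain ⟨l, hl⟩ := Function.ne_iff.1 h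
      exact Finset.prod_eq_zero (Finset.mem_univ l) (if_neg hl)
  unfold residueMap
  simp [hwave]

/-- Near the integer points `residueMap` is Lipschitz with a constant that is linear in the size of
the point. -/
theorem exists_abs_residueMap_sub_le {N : ℕ} [NeZero N]
    (α : (Fin 3 → Fin N) → Fin 3 → Fin 3 → ℚ) (β : (Fin 3 → Fin N) → Fin 3 → ℚ) :
    ∃ A : ℝ, 0 ≤ A ∧ ∀ (w w' : Fin 3 → Fin N → ℝ) (η : ℝ), η ≤ 1 →
      (∀ i a, |w i a - w' i a| ≤ η) →
        ∀ i, |residueMap α β w i - residueMap α β w' i| ≤ A * η * (1 + ∑ j, |w' j 0|) := by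
  set c : (Fin 3 → Fin N) → Fin 3 → ℝ := fun ρ i => ∑ j, |(α ρ i j : ℝ)| + |(β ρ i : ℝ)|
  have hc : ∀ ρ i, 0 ≤ c ρ i := fun ρ i =>
    add_nonneg (Finset.sum_nonneg fun _ _ => abs_nonneg _) (abs_nonneg _)
  refine ⟨49 * ∑ i, ∑ ρ, c ρ i, mul_nonneg (by norm_num) (Finset.sum_nonneg fun i _ =>
    Finset.sum_nonneg fun ρ _ => hc ρ i), fun w w' η hη hw i => ?_⟩
  have hη0 : 0 ≤ η := (abs_nonneg _).trans (hw 0 0)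
  set X : ℝ := 1 + ∑ j, |w' j 0|
  have hX : 1 ≤ X := by
    have : 0 ≤ ∑ j, |w' j 0| := Finset.sum_nonneg fun _ _ => abs_nonneg _
    simp only [X]; linarith
  have hwX : ∀ j, |w j 0| ≤ 2 * X := by
    intro j
    have h1 : |w' j 0| ≤ ∑ j, |w' j 0| :=
      Finset.single_le_sum (f := fun j => |w' j 0|) (fun _ _ => abs_nonneg _) (Finset.mem_univ j)
    have h2 := abs_sub_abs_le_abs_sub (w j 0) (w' j 0)
    have h3 := hw j 0
    simp only [X] at hX ⊢
    linarith
  have hterm : ∀ ρ, |(∏ l, divisibilityWave N (w l (ρ l))) * (∑ j, (α ρ i j : ℝ) * w j 0 + β ρ i) -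
      (∏ l, divisibilityWave N (w' l (ρ l))) * (∑ j, (α ρ i j : ℝ) * w' j 0 + β ρ i)| ≤
        49 * c ρ i * η * X := by
    intro ρ
    have h1 := abs_prod_three_sub_le (η := 8 * η)
      (fun l => abs_divisibilityWave_le_one N (w l (ρ l)))
      (fun l => abs_divisibilityWave_le_one N (w' l (ρ l)))
      (fun l => (abs_divisibilityWave_sub_le N _ _).trans (by linarith [hw l (ρ l)]))
    have h2 : |∏ l, divisibilityWave N (w' l (ρ l))| ≤ 1 := by
      rw [Finset.abs_prod]
      exact Finset.prod_le_one (fun _ _ => abs_nonneg _) fun l _ => abs_divisibilityWave_le_one N _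
    have h3 : |∑ j, (α ρ i j : ℝ) * w j 0 + β ρ i| ≤ c ρ i * (2 * X) := by
      refine (abs_add_le _ _).trans ?_
      simp only [c, add_mul, Finset.sum_mul]
      refine add_le_add ((Finset.abs_sum_le_sum_abs _ _).trans (Finset.sum_le_sum fun j _ => ?_)) ?_
      · rw [abs_mul]
        exact mul_le_mul_of_nonneg_left (hwX j) (abs_nonneg _)
      · exact le_mul_of_one_le_right (abs_nonneg _) (by linarith)
    have h4 : |(∑ j, (α ρ i j : ℝ) * w j 0 + β ρ i) - (∑ j, (α ρ i j : ℝ) * w' j 0 + β ρ i)| ≤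
        c ρ i * η := by
      rw [add_sub_add_right_eq_sub, ← Finset.sum_sub_distrib]
      refine (Finset.abs_sum_le_sum_abs _ _).trans ?_
      simp only [c, add_mul, Finset.sum_mul]
      refine (Finset.sum_le_sum fun j _ => ?_).trans
        (le_add_of_nonneg_right (mul_nonneg (abs_nonneg _) hη0))
      rw [← mul_sub, abs_mul]
      exact mul_le_mul_of_nonneg_left (hw j 0) (abs_nonneg _)
    generalize (∏ l, divisibilityWave N (w l (ρ l))) = p at h1 ⊢
    generalize (∏ l, divisibilityWave N (w' l (ρ l))) = p' at h1 h2 ⊢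
    generalize (∑ j, (α ρ i j : ℝ) * w j 0 + β ρ i) = m at h3 h4 ⊢
    generalize (∑ j, (α ρ i j : ℝ) * w' j 0 + β ρ i) = m' at h4 ⊢
    have h5 : p * m - p' * m' = (p - p') * m + p' * (m - m') := by ring
    rw [h5]
    refine (abs_add_le _ _).trans ?_
    rw [abs_mul, abs_mul]
    have h6 := mul_le_mul h1 h3 (abs_nonneg _) (by positivity)
    have h7 := mul_le_mul h2 h4 (abs_nonneg _) zero_le_one
    have h8 := mul_nonneg (mul_nonneg (hc ρ i) hη0) (sub_nonneg.2 hX)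
    linarith
  unfold residueMap
  rw [← Finset.sum_sub_distrib]
  refine (Finset.abs_sum_le_sum_abs _ _).trans ((Finset.sum_le_sum fun ρ _ => hterm ρ).trans ?_)
  rw [← Finset.sum_mul, ← Finset.sum_mul, ← Finset.mul_sum]
  gcongr
  exact Finset.single_le_sum (f := fun i => ∑ ρ, c ρ i)
    (fun i _ => Finset.sum_nonneg fun ρ _ => hc ρ i) (Finset.mem_univ i)

/-- The coefficients `α`, `β` describe each step of the sequence `x` of integer points. -/
def IsResidueOrbit {N : ℕ} (α : (Fin 3 → Fin N) → Fin 3 → Fin 3 → ℚ)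
    (β : (Fin 3 → Fin N) → Fin 3 → ℚ) (x : ℕ → Fin 3 → ℤ) : Prop :=
  ∀ n (ρ : Fin 3 → Fin N), (∀ l, (N : ℤ) ∣ x n l - (ρ l : ℕ)) →
    ∀ i, (x (n + 1) i : ℚ) = ∑ j, α ρ i j * x n j + β ρ i

theorem exists_forall_abs_residueMap_sub_le {N : ℕ} [NeZero N]
    (α : (Fin 3 → Fin N) → Fin 3 → Fin 3 → ℚ) (β : (Fin 3 → Fin N) → Fin 3 → ℚ) :
    ∃ k : ℕ, 10000 ≤ k ∧ ∀ x, IsResidueOrbit α β x → ∀ n, ∀ w : Fin 3 → Fin N → ℝ,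
      (∀ i a, |w i a - (x n i - (a : ℕ))| ≤ 100 / (k * (1 + ∑ i, |(x n i : ℝ)|))) →
        ∀ i, |residueMap α β w i - x (n + 1) i| ≤ 1 / 64 := by
  obtain ⟨A, hA0, hA⟩ := exists_abs_residueMap_sub_le α β
  refine ⟨10000 + ⌈6400 * A⌉₊, Nat.le_add_right _ _, fun x hx n w hw i => ?_⟩
  have hk1 : 6400 * A ≤ ((10000 + ⌈6400 * A⌉₊ : ℕ) : ℝ) := by
    push_cast
    linarith [Nat.le_ceil (6400 * A)]
  have hk0 : (10000 : ℝ) ≤ ((10000 + ⌈6400 * A⌉₊ : ℕ) : ℝ) := by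
    exact_mod_cast Nat.le_add_right _ _
  generalize ((10000 + ⌈6400 * A⌉₊ : ℕ) : ℝ) = k at hk1 hk0 hw
  have hX : 1 ≤ 1 + ∑ i, |(x n i : ℝ)| := by
    have : 0 ≤ ∑ i, |(x n i : ℝ)| := Finset.sum_nonneg fun _ _ => abs_nonneg _
    linarith
  have hN : (0 : ℤ) < N := by exact_mod_cast NeZero.pos N
  have hρ : ∀ l, (N : ℤ) ∣ x n l - ((⟨(x n l % N).toNat, by
      have := Int.emod_nonneg (x n l) hN.ne'
      have := Int.emod_lt_of_pos (x n l) hN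
      omega⟩ : Fin N) : ℕ) := fun l => by
    rw [Fin.val_mk, Int.toNat_of_nonneg (Int.emod_nonneg _ hN.ne')]
    exact Int.dvd_self_sub_emod
  have h1 := residueMap_of_forall_dvd α β hρ i
  have h2 := hx n _ hρ i
  have h3 : (x (n + 1) i : ℝ) = residueMap α β (fun j a => x n j - (a : ℕ)) i := by
    rw [h1, ← Rat.cast_intCast, h2]
    push_cast
    rfl
  have h4 := hA w (fun j a => x n j - (a : ℕ)) _ (by
    rw [div_le_one (by positivity)]
    nlinarith) hw i
  rw [← h3] at h4
  simp only [Fin.val_zero, Nat.cast_zero, sub_zero] at h4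
  refine h4.trans ?_
  have h5 : A * (100 / (k * (1 + ∑ i, |(x n i : ℝ)|))) * (1 + ∑ i, |(x n i : ℝ)|) = A * 100 / k := by
    have : 0 < 1 + ∑ i, |(x n i : ℝ)| := by linarith
    field_simp
  rw [h5, div_le_div_iff₀ (by linarith) (by norm_num)]
  linarith

end

section

open Set

/-! ### The polynomial vector field -/

/-- The auxiliary coordinates of the vector field. -/
inductive Aux (N : ℕ)
  | copy (i : Fin 3) (a : Fin N)
  | copyCos (i : Fin 3) (a : Fin N)
  | copySin (i : Fin 3) (a : Fin N)
  | zCos (i : Fin 3)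
  | zSin (i : Fin 3)
  | clockCos
  | clockSin
  | scale
  | openA
  | openB
  | twoPi
  deriving Fintype

/-- All coordinates: the time, the three coordinates of `z`, and the auxiliary ones. -/
abbrev Coord (N : ℕ) := Fin 4 ⊕ Aux N

namespace Coord

open MvPolynomial

/-- The coordinate `z i`. -/
abbrev z {N : ℕ} (i : Fin 3) : Coord N := Sum.inl i.succ

/-- An auxiliary coordinate. -/
abbrev aux {N : ℕ} (c : Aux N) : Coord N := Sum.inr c

variable {N : ℕ} [NeZero N] (α : (Fin 3 → Fin N) → Fin 3 → Fin 3 → ℚ)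
  (β : (Fin 3 → Fin N) → Fin 3 → ℚ) (k : ℕ)

/-- `divisibilityWave` as a polynomial in a cosine. -/
noncomputable def wavePoly (l : Fin 3) (a : Fin N) : MvPolynomial (Coord N) ℚ :=
  C (1 / N : ℚ) * ∑ n ∈ Finset.range N,
    Polynomial.aeval (X (aux (.copyCos l a))) (Polynomial.Chebyshev.T ℚ n)

/-- `residueMap` as a polynomial. -/
noncomputable def targetPoly (i : Fin 3) : MvPolynomial (Coord N) ℚ :=
  ∑ ρ : Fin 3 → Fin N, (∏ l, wavePoly l (ρ l)) *
    (∑ j, C (α ρ i j) * X (aux (.copy j 0)) + C (β ρ i))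

/-- The velocity of `z i`. -/
noncomputable def zPoly (i : Fin 3) : MvPolynomial (Coord N) ℚ :=
  -X (aux .openA) * X (aux (.zSin i)) + X (aux .openB) * (targetPoly α β i - X (z i)) ^ 3

/-- The velocity of the copy of `z i - a`. -/
noncomputable def copyPoly (i : Fin 3) (a : Fin N) : MvPolynomial (Coord N) ℚ :=
  X (aux .openA) * (X (z i) - C ((a : ℕ) : ℚ) - X (aux (.copy i a))) ^ 3

/-- The velocity of the variable that controls the gates. -/
noncomputable def scalePoly : MvPolynomial (Coord N) ℚ :=
  C ((k : ℚ) ^ 2) * (1 + ∑ i, X (z i) ^ 2 + ∑ i, (targetPoly α β i - X (z i)) ^ 6 +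
    ∑ i, ∑ a : Fin N, (X (z i) - C ((a : ℕ) : ℚ) - X (aux (.copy i a))) ^ 6)

/-- The vector field that simulates the iteration of a map that is affine on residue classes. -/
noncomputable def field : Coord N → MvPolynomial (Coord N) ℚ
  | .inl i => Fin.cases 1 (zPoly α β) i
  | .inr (.copy i a) => copyPoly i a
  | .inr (.copyCos i a) =>
      -(X (aux .twoPi) * C (1 / N : ℚ) * copyPoly i a) * X (aux (.copySin i a))
  | .inr (.copySin i a) => X (aux .twoPi) * C (1 / N : ℚ) * copyPoly i a * X (aux (.copyCos i a))
  | .inr (.zCos i) => -(X (aux .twoPi) * zPoly α β i) * X (aux (.zSin i))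
  | .inr (.zSin i) => X (aux .twoPi) * zPoly α β i * X (aux (.zCos i))
  | .inr .clockCos => -X (aux .twoPi) * X (aux .clockSin)
  | .inr .clockSin => X (aux .twoPi) * X (aux .clockCos)
  | .inr .scale => scalePoly α β k
  | .inr .openA => X (aux .openA) * (scalePoly α β k * (X (aux .clockSin) - C (1 / 2)) +
      X (aux .scale) * (X (aux .twoPi) * X (aux .clockCos)))
  | .inr .openB => X (aux .openB) * (scalePoly α β k * (-X (aux .clockSin) - C (1 / 2)) -
      X (aux .scale) * (X (aux .twoPi) * X (aux .clockCos)))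
  | .inr .twoPi => 0

/-- The initial values of the auxiliary coordinates. -/
noncomputable def initial {N : ℕ} : Aux N → ℝ
  | .copy _ _ => 0
  | .copyCos _ _ => 1
  | .copySin _ _ => 0
  | .zCos _ => 1
  | .zSin _ => 0
  | .clockCos => 1
  | .clockSin => 0
  | .scale => 0
  | .openA => 1
  | .openB => 1
  | .twoPi => 2 * Real.pi

theorem isComputableReal_initial {N : ℕ} (c : Aux N) : IsComputableReal (initial c) := by
  have h0 : IsComputableReal 0 := by simpa using isComputableReal_ratCast 0
  have h1 : IsComputableReal 1 := by simpa using isComputableReal_ratCast 1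
  cases c <;> simp only [initial, h0, h1, isComputableReal_two_pi]

variable {α β k}

theorem aeval_targetPoly {w : Coord N → ℝ}
    (hw : ∀ l a, w (aux (.copyCos l a)) = Real.cos (2 * Real.pi / N * w (aux (.copy l a))))
    (i : Fin 3) :
    aeval w (targetPoly α β i) = residueMap α β (fun j a => w (aux (.copy j a))) i := by
  have h : ∀ l (a : Fin N), aeval w (wavePoly l a) = divisibilityWave N (w (aux (.copy l a))) := by
    intro l a
    simp only [wavePoly, divisibilityWave, map_mul, map_sum, aeval_C]
    congr 1
    · simp
    · refine Finset.sum_congr rfl fun n _ => ?_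
      rw [← Polynomial.aeval_algHom_apply, aeval_X, hw, Polynomial.aeval_def,
        Polynomial.eval₂_eq_eval_map, Polynomial.Chebyshev.map_T, Polynomial.Chebyshev.T_real_cos]
      simp
  simp only [targetPoly, residueMap, map_sum, map_mul, map_prod, map_add, aeval_C, aeval_X, h]
  rfl

end Coord

theorem eq_of_hasDerivAt_zero {f f' : ℝ → ℝ} {t : ℝ} (ht : 0 ≤ t)
    (hf : ∀ s ∈ Icc 0 t, HasDerivAt f (f' s) s) (h0 : ∀ s ∈ Icc 0 t, f' s = 0) : f t = f 0 := by
  have := abs_sub_le_of_abs_deriv_le (D := fun _ => 0) (D' := fun _ => 0) ht hf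
    (fun s _ => hasDerivAt_const s 0) (fun s hs => by simp [h0 s hs])
  rwa [sub_self, abs_nonpos_iff, sub_eq_zero] at this

theorem eq_cos_and_eq_sin_of_hasDerivAt {c s θ θ' : ℝ → ℝ} {t : ℝ} (ht : 0 ≤ t)
    (hc : ∀ r ∈ Icc 0 t, HasDerivAt c (-θ' r * s r) r)
    (hs : ∀ r ∈ Icc 0 t, HasDerivAt s (θ' r * c r) r)
    (hθ : ∀ r ∈ Icc 0 t, HasDerivAt θ (θ' r) r) (hc0 : c 0 = Real.cos (θ 0))
    (hs0 : s 0 = Real.sin (θ 0)) : c t = Real.cos (θ t) ∧ s t = Real.sin (θ t) := by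
  have h := eq_of_hasDerivAt_zero ht (f := fun r => (c r - Real.cos (θ r)) ^ 2 +
    (s r - Real.sin (θ r)) ^ 2) (fun r hr => (((hc r hr).sub (hθ r hr).cos).pow 2).add
      (((hs r hr).sub (hθ r hr).sin).pow 2)) (fun r _ => by simp; ring)
  simp only [hc0, hs0, sub_self] at h
  have h1 := sq_nonneg (c t - Real.cos (θ t))
  have h2 := sq_nonneg (s t - Real.sin (θ t))
  constructor
  · rw [← sub_eq_zero, ← sq_eq_zero_iff]; linarith
  · rw [← sub_eq_zero, ← sq_eq_zero_iff]; linarith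

theorem eq_mul_exp_of_hasDerivAt {y e e' : ℝ → ℝ} {t : ℝ} (ht : 0 ≤ t)
    (hy : ∀ r ∈ Icc 0 t, HasDerivAt y (y r * e' r) r)
    (he : ∀ r ∈ Icc 0 t, HasDerivAt e (e' r) r) : y t = y 0 * Real.exp (e t - e 0) := by
  have h := eq_of_hasDerivAt_zero ht (f := fun r => y r * Real.exp (-e r))
    (fun r hr => (hy r hr).mul (he r hr).neg.exp) (fun r _ => by simp; ring)
  rw [sub_eq_add_neg, add_comm, Real.exp_add, ← mul_assoc, ← h, mul_assoc, ← Real.exp_add]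
  simp

/-- `W` solves the simulating equation on `[0, T]`, with initial values `(0, x₀, initial)`. -/
structure IsSolution {N : ℕ} [NeZero N] (α : (Fin 3 → Fin N) → Fin 3 → Fin 3 → ℚ)
    (β : (Fin 3 → Fin N) → Fin 3 → ℚ) (k : ℕ) (x₀ : Fin 3 → ℤ) (T : ℝ) (W : ℝ → Coord N → ℝ) :
    Prop where
  hasDerivAt : ∀ t ∈ Icc 0 T, ∀ c,
    HasDerivAt (fun s => W s c) (MvPolynomial.aeval (W t) (Coord.field α β k c)) t
  time_zero : W 0 (Sum.inl 0) = 0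
  z_zero : ∀ i, W 0 (Coord.z i) = x₀ i
  aux_zero : ∀ c, W 0 (Coord.aux c) = Coord.initial c

namespace IsSolution

open MvPolynomial Coord

variable {N : ℕ} [NeZero N] {α : (Fin 3 → Fin N) → Fin 3 → Fin 3 → ℚ}
  {β : (Fin 3 → Fin N) → Fin 3 → ℚ} {k : ℕ} {x₀ : Fin 3 → ℤ} {T : ℝ} {W : ℝ → Coord N → ℝ}

theorem time_eq (h : IsSolution α β k x₀ T W) {t : ℝ} (ht : t ∈ Icc 0 T) :
    W t (Sum.inl 0) = t := by
  have := eq_of_hasDerivAt_zero ht.1 (f := fun s => W s (Sum.inl 0) - s)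
    (fun s hs => (h.hasDerivAt s ⟨hs.1, hs.2.trans ht.2⟩ _).sub (hasDerivAt_id s))
    (fun s _ => by simp [Coord.field])
  simp only [h.time_zero] at this
  linarith

theorem twoPi_eq (h : IsSolution α β k x₀ T W) {t : ℝ} (ht : t ∈ Icc 0 T) :
    W t (aux .twoPi) = 2 * Real.pi := by
  have := eq_of_hasDerivAt_zero ht.1 (f := fun s => W s (aux .twoPi))
    (fun s hs => (h.hasDerivAt s ⟨hs.1, hs.2.trans ht.2⟩ _))
    (fun s _ => by simp [Coord.field])
  simpa only [h.aux_zero, initial] using this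

theorem copyCos_eq (h : IsSolution α β k x₀ T W) {t : ℝ} (ht : t ∈ Icc 0 T) (i : Fin 3)
    (a : Fin N) :
    W t (aux (.copyCos i a)) = Real.cos (2 * Real.pi / N * W t (aux (.copy i a))) ∧
      W t (aux (.copySin i a)) = Real.sin (2 * Real.pi / N * W t (aux (.copy i a))) := by
  have hmem : ∀ s ∈ Icc 0 t, s ∈ Icc 0 T := fun s hs => ⟨hs.1, hs.2.trans ht.2⟩
  refine eq_cos_and_eq_sin_of_hasDerivAt ht.1
    (θ' := fun s => 2 * Real.pi / N * aeval (W s) (copyPoly i a))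
    (c := fun s => W s (aux (.copyCos i a))) (s := fun s => W s (aux (.copySin i a)))
    (θ := fun s => 2 * Real.pi / N * W s (aux (.copy i a)))
    (fun s hs => (h.hasDerivAt s (hmem s hs) _).congr_deriv ?_)
    (fun s hs => (h.hasDerivAt s (hmem s hs) _).congr_deriv ?_)
    (fun s hs => (h.hasDerivAt s (hmem s hs) (aux (.copy i a))).const_mul _) ?_ ?_
  · simp only [Coord.field, map_mul, map_neg, aeval_X, aeval_C, h.twoPi_eq (hmem s hs)]
    simp [div_eq_mul_inv]
  · simp only [Coord.field, map_mul, aeval_X, aeval_C, h.twoPi_eq (hmem s hs)]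
    simp [div_eq_mul_inv]
  · simp [h.aux_zero, initial]
  · simp [h.aux_zero, initial]

theorem zCos_eq (h : IsSolution α β k x₀ T W) {t : ℝ} (ht : t ∈ Icc 0 T) (i : Fin 3) :
    W t (aux (.zCos i)) = Real.cos (2 * Real.pi * W t (z i)) ∧
      W t (aux (.zSin i)) = Real.sin (2 * Real.pi * W t (z i)) := by
  have hmem : ∀ s ∈ Icc 0 t, s ∈ Icc 0 T := fun s hs => ⟨hs.1, hs.2.trans ht.2⟩
  refine eq_cos_and_eq_sin_of_hasDerivAt ht.1
    (θ' := fun s => 2 * Real.pi * aeval (W s) (zPoly α β i))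
    (c := fun s => W s (aux (.zCos i))) (s := fun s => W s (aux (.zSin i)))
    (θ := fun s => 2 * Real.pi * W s (z i))
    (fun s hs => (h.hasDerivAt s (hmem s hs) _).congr_deriv ?_)
    (fun s hs => (h.hasDerivAt s (hmem s hs) _).congr_deriv ?_)
    (fun s hs => (h.hasDerivAt s (hmem s hs) (z i)).const_mul _) ?_ ?_
  · simp only [Coord.field, map_mul, map_neg, aeval_X, h.twoPi_eq (hmem s hs)]
  · simp only [Coord.field, map_mul, aeval_X, h.twoPi_eq (hmem s hs)]
  · simp only [h.aux_zero, h.z_zero, initial]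
    rw [mul_comm, Real.cos_int_mul_two_pi]
  · simp only [h.aux_zero, h.z_zero, initial]
    simpa [mul_comm] using (Real.sin_add_int_mul_two_pi 0 (x₀ i)).symm

theorem clockCos_eq (h : IsSolution α β k x₀ T W) {t : ℝ} (ht : t ∈ Icc 0 T) :
    W t (aux .clockCos) = Real.cos (2 * Real.pi * t) ∧ W t (aux .clockSin) = clock t := by
  have hmem : ∀ s ∈ Icc 0 t, s ∈ Icc 0 T := fun s hs => ⟨hs.1, hs.2.trans ht.2⟩
  refine eq_cos_and_eq_sin_of_hasDerivAt ht.1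
    (θ' := fun s => 2 * Real.pi * 1)
    (c := fun s => W s (aux .clockCos)) (s := fun s => W s (aux .clockSin))
    (θ := fun s => 2 * Real.pi * s)
    (fun s hs => (h.hasDerivAt s (hmem s hs) _).congr_deriv ?_)
    (fun s hs => (h.hasDerivAt s (hmem s hs) _).congr_deriv ?_)
    (fun s hs => (hasDerivAt_id s).const_mul _) ?_ ?_
  · simp only [Coord.field, map_mul, map_neg, aeval_X, h.twoPi_eq (hmem s hs), mul_one]
  · simp only [Coord.field, map_mul, aeval_X, h.twoPi_eq (hmem s hs), mul_one]
  · simp [h.aux_zero, initial]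
  · simp [h.aux_zero, initial]

theorem hasDerivAt_clock (t : ℝ) :
    HasDerivAt clock (2 * Real.pi * Real.cos (2 * Real.pi * t)) t := by
  have h1 : HasDerivAt (fun s : ℝ => 2 * Real.pi * s) (2 * Real.pi) t := by
    simpa using (hasDerivAt_id t).const_mul (2 * Real.pi)
  exact h1.sin.congr_deriv (mul_comm _ _)

theorem openA_eq (h : IsSolution α β k x₀ T W) {t : ℝ} (ht : t ∈ Icc 0 T) :
    W t (aux .openA) = gateA (fun s => W s (aux .scale)) t := by
  have hmem : ∀ s ∈ Icc 0 t, s ∈ Icc 0 T := fun s hs => ⟨hs.1, hs.2.trans ht.2⟩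
  have := eq_mul_exp_of_hasDerivAt ht.1 (y := fun s => W s (aux .openA))
    (e := fun s => W s (aux .scale) * (clock s - 1 / 2))
    (fun s hs => (h.hasDerivAt s (hmem s hs) _).congr_deriv (by
      simp only [Coord.field, map_mul, map_add, map_sub, aeval_X, h.twoPi_eq (hmem s hs),
        (h.clockCos_eq (hmem s hs)).1, (h.clockCos_eq (hmem s hs)).2, aeval_C]
      rfl))
    (fun s hs => ((h.hasDerivAt s (hmem s hs) (aux .scale)).mul
      ((hasDerivAt_clock s).sub_const _)).congr_deriv (by simp [Coord.field]))
  simpa [h.aux_zero, initial, gateA] using this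

theorem openB_eq (h : IsSolution α β k x₀ T W) {t : ℝ} (ht : t ∈ Icc 0 T) :
    W t (aux .openB) = gateB (fun s => W s (aux .scale)) t := by
  have hmem : ∀ s ∈ Icc 0 t, s ∈ Icc 0 T := fun s hs => ⟨hs.1, hs.2.trans ht.2⟩
  have := eq_mul_exp_of_hasDerivAt ht.1 (y := fun s => W s (aux .openB))
    (e := fun s => W s (aux .scale) * (-clock s - 1 / 2))
    (fun s hs => (h.hasDerivAt s (hmem s hs) _).congr_deriv (by
      simp only [Coord.field, map_mul, map_sub, map_neg, aeval_X, h.twoPi_eq (hmem s hs),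
        (h.clockCos_eq (hmem s hs)).1, (h.clockCos_eq (hmem s hs)).2, aeval_C]
      rfl))
    (fun s hs => ((h.hasDerivAt s (hmem s hs) (aux .scale)).mul
      ((hasDerivAt_clock s).neg.sub_const _)).congr_deriv (by simp [Coord.field]; ring))
  simpa [h.aux_zero, initial, gateB] using this

theorem isTrajectory (h : IsSolution α β k x₀ T W) :
    IsTrajectory (residueMap α β) ((k : ℝ) ^ 2) T (fun i t => W t (z i))
      (fun i a t => W t (aux (.copy i a))) (fun t => W t (aux .scale)) where
  hasDerivAt_z t ht i := (h.hasDerivAt t ht (z i)).congr_deriv (by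
    simp only [Coord.field, Fin.cases_succ, zPoly, map_add, map_mul, map_neg, map_sub, map_pow,
      aeval_X, aeval_targetPoly fun l a => (h.copyCos_eq ht l a).1, h.openA_eq ht, h.openB_eq ht,
      (h.zCos_eq ht i).2])
  hasDerivAt_v t ht i a := (h.hasDerivAt t ht (aux (.copy i a))).congr_deriv (by
    simp [Coord.field, copyPoly, h.openA_eq ht])
  hasDerivAt_u t ht := (h.hasDerivAt t ht (aux .scale)).congr_deriv (by
    simp only [Coord.field, scalePoly, growth, map_add, map_mul, map_sub, map_pow, map_sum, map_one,
      aeval_X, aeval_C, aeval_targetPoly fun l a => (h.copyCos_eq ht l a).1]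
    simp)
  u_zero := h.aux_zero _

end IsSolution

end

section

open Set MvPolynomial Coord

/-- The numbering of the coordinates. -/
noncomputable def Coord.equivFin (N : ℕ) : Coord N ≃ Fin (Fintype.card (Aux N) + 4) :=
  ((Equiv.refl _).sumCongr (Fintype.equivFin (Aux N))).trans
    (finSumFinEquiv.trans (finCongr (Nat.add_comm _ _)))

theorem Coord.initialPoint_equivFin_inl {N : ℕ} (y : Fin (Fintype.card (Aux N)) → ℝ) (x : ℕ × ℕ × ℕ)
    (i : Fin 4) : initialPoint x y (equivFin N (Sum.inl i)) =
      ![(0 : ℝ), x.1, x.2.1, x.2.2] i := by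
  fin_cases i <;> rfl

theorem Coord.initialPoint_equivFin_inr {N : ℕ} (y : Fin (Fintype.card (Aux N)) → ℝ) (x : ℕ × ℕ × ℕ)
    (c : Aux N) : initialPoint x y (equivFin N (Sum.inr c)) = y (Fintype.equivFin _ c) := by
  have : equivFin N (Sum.inr c) = (Fintype.equivFin _ c).succ.succ.succ.succ := by
    ext
    simp [equivFin]
  rw [this]
  rfl

variable {N : ℕ} [NeZero N] {α : (Fin 3 → Fin N) → Fin 3 → Fin 3 → ℚ}
  {β : (Fin 3 → Fin N) → Fin 3 → ℚ} {k : ℕ}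

theorem IsSolution.exists_bound (hk : 10000 ≤ k) {x : ℕ → Fin 3 → ℤ}
    (hF : ∀ n, ∀ w : Fin 3 → Fin N → ℝ,
      (∀ i a, |w i a - (x n i - (a : ℕ))| ≤ 100 / (k * (1 + ∑ i, |(x n i : ℝ)|))) →
        ∀ i, |residueMap α β w i - x (n + 1) i| ≤ 1 / 64) (T : ℝ) :
    ∃ R, ∀ t ∈ Icc 0 T, ∀ W, IsSolution α β k (x 0) t W → ∀ c, |W t c| < R := by
  obtain ⟨R, hR⟩ := IsTrajectory.exists_bound (k := k) (by exact_mod_cast hk)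
    (continuous_residueMap α β) hF T
  refine ⟨T + |R| + Real.exp (2 * |R|) + 8, fun t ht W h c => ?_⟩
  obtain ⟨h1, h2, h3⟩ := hR t ht _ _ _ h.isTrajectory h.z_zero fun i a => h.aux_zero _
  have ht' : t ∈ Icc 0 t := ⟨ht.1, le_rfl⟩
  have hT : 0 ≤ T := ht.1.trans ht.2
  have hR0 := abs_nonneg R
  have hRR := le_abs_self R
  have hE := Real.exp_pos (2 * |R|)
  have hc := Real.neg_one_le_sin (2 * Real.pi * t)
  have hc' := Real.sin_le_one (2 * Real.pi * t)
  have hgate : ∀ y, |y| ≤ 2 → |Real.exp (W t (aux .scale) * y)| ≤ Real.exp (2 * |R|) := by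
    intro y hy
    rw [Real.abs_exp, Real.exp_le_exp]
    refine (le_abs_self _).trans ?_
    rw [abs_mul, mul_comm 2]
    exact mul_le_mul (h3.trans hRR) hy (abs_nonneg _) hR0
  rcases c with i | c
  · induction i using Fin.cases with
    | zero =>
      rw [h.time_eq ht', abs_of_nonneg ht.1]
      linarith [ht.2]
    | succ i => linarith [h1 i]
  · cases c with
    | copy i a => linarith [h2 i a]
    | copyCos i a =>
      have := Real.abs_cos_le_one (2 * Real.pi / N * W t (aux (.copy i a)))
      rw [← (h.copyCos_eq ht' i a).1] at this
      linarith
    | copySin i a =>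
      have := Real.abs_sin_le_one (2 * Real.pi / N * W t (aux (.copy i a)))
      rw [← (h.copyCos_eq ht' i a).2] at this
      linarith
    | zCos i =>
      have := Real.abs_cos_le_one (2 * Real.pi * W t (z i))
      rw [← (h.zCos_eq ht' i).1] at this
      linarith
    | zSin i =>
      have := Real.abs_sin_le_one (2 * Real.pi * W t (z i))
      rw [← (h.zCos_eq ht' i).2] at this
      linarith
    | clockCos =>
      have := Real.abs_cos_le_one (2 * Real.pi * t)
      rw [← (h.clockCos_eq ht').1] at this
      linarith
    | clockSin =>
      have := Real.abs_sin_le_one (2 * Real.pi * t)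
      rw [← clock, ← (h.clockCos_eq ht').2] at this
      linarith
    | scale => linarith
    | openA =>
      have := hgate (clock t - 1 / 2) (by unfold clock; rw [abs_le]; constructor <;> linarith)
      rw [← gateA.eq_1 (fun s => W s (aux .scale)) t, ← h.openA_eq ht'] at this
      linarith
    | openB =>
      have := hgate (-clock t - 1 / 2) (by unfold clock; rw [abs_le]; constructor <;> linarith)
      rw [← gateB.eq_1 (fun s => W s (aux .scale)) t, ← h.openB_eq ht'] at this
      linarith
    | twoPi =>
      have := h.twoPi_eq ht'
      have hp := Real.pi_pos
      rw [this, abs_of_pos (by positivity)]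
      linarith [Real.pi_lt_four]

theorem contDiff_polyField {n : ℕ} (p : Fin n → MvPolynomial (Fin n) ℝ) :
    ContDiff ℝ 1 (polyField p) :=
  contDiff_pi.2 fun i => (AnalyticOnNhd.eval_mvPolynomial (p i)).contDiff

/-- A map of `ℤ³` that is affine, with rational coefficients, on residue classes can be iterated by
a polynomial vector field with a clock. -/
theorem exists_polyField_simulating (α : (Fin 3 → Fin N) → Fin 3 → Fin 3 → ℚ)
    (β : (Fin 3 → Fin N) → Fin 3 → ℚ) :
    ∃ (m : ℕ) (p : Fin (m + 4) → MvPolynomial (Fin (m + 4)) ℝ) (y₀ : Fin m → ℝ),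
      p 0 = 1 ∧ (∀ i d, IsComputableReal ((p i).coeff d)) ∧ (∀ i, IsComputableReal (y₀ i)) ∧
      ∀ (x : ℕ → Fin 3 → ℤ) (x₀ : ℕ × ℕ × ℕ), IsResidueOrbit α β x →
        x 0 = ![(x₀.1 : ℤ), x₀.2.1, x₀.2.2] →
        (∀ (Z : ℝ → Fin (m + 4) → ℝ) (a b : ℝ), a < 0 → 0 < b → Z 0 = initialPoint x₀ y₀ →
          IsIntegralCurveOn Z (fun _ => polyField p) (Ioo a b) → ∀ τ ∈ Ioo a b, Z τ 0 = τ ∧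
            ∀ n : ℕ, n ≤ τ → τ ≤ n + 1 / 2 →
              |Z τ 1 - x n 0| ≤ 1 / 8 ∧ |Z τ 2 - x n 1| ≤ 1 / 8 ∧ |Z τ 3 - x n 2| ≤ 1 / 8) ∧
        ∀ T : ℝ, 0 < T → ∃ (Z : ℝ → Fin (m + 4) → ℝ) (a : ℝ), a < 0 ∧ Z 0 = initialPoint x₀ y₀ ∧
          IsIntegralCurveOn Z (fun _ => polyField p) (Ioo a T) := by
  obtain ⟨k, hk, hF⟩ := exists_forall_abs_residueMap_sub_le α β
  have hkR : (10000 : ℝ) ≤ k := by exact_mod_cast hk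
  set E := equivFin N
  set p : Fin (Fintype.card (Aux N) + 4) → MvPolynomial (Fin (Fintype.card (Aux N) + 4)) ℝ :=
    fun i => map (algebraMap ℚ ℝ) (rename E (field α β k (E.symm i)))
  set y₀ : Fin (Fintype.card (Aux N)) → ℝ := fun i => initial ((Fintype.equivFin (Aux N)).symm i)
  have hp0 : p 0 = 1 := by
    have h0 : (0 : Fin (Fintype.card (Aux N) + 4)) = E (Sum.inl 0) := rfl
    simp only [p]
    rw [h0, Equiv.symm_apply_apply]
    simp [field]
  have hp : ∀ Z c, polyField p Z (E c) = aeval (fun c => Z (E c)) (field α β k c) := fun Z c => by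
    simp only [polyField, p, Equiv.symm_apply_apply]
    rw [eval_map, ← aeval_def, aeval_rename]
    rfl
  refine ⟨_, p, y₀, hp0, fun i d => ?_, fun i => isComputableReal_initial _,
    fun x x₀ hx hx0 => ?_⟩
  · simp only [p, coeff_map]
    exact isComputableReal_ratCast _
  · have hsol : ∀ (Z : ℝ → Fin (Fintype.card (Aux N) + 4) → ℝ) (T : ℝ),
        Z 0 = initialPoint x₀ y₀ → (∀ s ∈ Icc 0 T, HasDerivAt Z (polyField p (Z s)) s) →
        IsSolution α β k (x 0) T fun s c => Z s (E c) := by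
      intro Z T hZ0 hZ
      refine ⟨fun t ht c => ?_, ?_, fun i => ?_, fun c => ?_⟩
      · have := hasDerivAt_pi.1 (hZ t ht) (E c)
        rwa [hp] at this
      · simp only [hZ0]
        exact initialPoint_equivFin_inl y₀ x₀ 0
      · simp only [hZ0, hx0]
        rw [initialPoint_equivFin_inl y₀ x₀ i.succ]
        fin_cases i <;> rfl
      · simp only [hZ0]
        rw [initialPoint_equivFin_inr y₀ x₀ c]
        simp [y₀]
    refine ⟨fun Z a b ha hb hZ0 hZ τ hτ => ?_, fun T hT => ?_⟩
    · have hder : ∀ s ∈ Ioo a b, HasDerivAt Z (polyField p (Z s)) s := fun s hs =>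
        (hZ s hs).hasDerivAt (Ioo_mem_nhds hs.1 hs.2)
      have htime : Z τ 0 = τ := by
        have h1 : ∀ s ∈ Ioo a b, HasDerivAt (fun s => Z s 0) 1 s := fun s hs => by
          simpa [polyField, hp0] using hasDerivAt_pi.1 (hder s hs) 0
        have h2 : Z 0 0 = 0 := by rw [hZ0]; rfl
        rcases le_total 0 τ with h | h
        · have h3 := eq_of_hasDerivAt_zero h (f := fun s => Z s 0 - s)
            (fun s hs => (h1 s ⟨ha.trans_le hs.1, hs.2.trans_lt hτ.2⟩).sub (hasDerivAt_id s))
            (fun s _ => by simp)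
          simp only [h2] at h3
          linarith
        · have h3 := abs_sub_le_of_abs_deriv_le (y := fun s => Z s 0 - s) (D := fun _ => 0)
            (D' := fun _ => 0) h
            (fun s hs => (h1 s ⟨hτ.1.trans_le hs.1, hs.2.trans_lt hb⟩).sub (hasDerivAt_id s))
            (fun s _ => hasDerivAt_const s 0) (fun s _ => by simp)
          simp only [h2, sub_self, abs_nonpos_iff] at h3
          linarith
      refine ⟨htime, fun n h1 h2 => ?_⟩
      have hs := hsol Z τ hZ0 fun s hs => hder s ⟨ha.trans_le hs.1, hs.2.trans_lt hτ.2⟩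
      have hz := fun i => hs.isTrajectory.abs_z_sub_le_of_first_half (n := n) (x := x n) (i := i)
        (by nlinarith)
        (hs.isTrajectory.abs_z_nat_sub_le hkR hs.z_zero (hF x hx) n h1 i) h1 h2 le_rfl
      exact ⟨hz 0, hz 1, hz 2⟩
    · obtain ⟨R, hR⟩ := IsSolution.exists_bound hk (hF x hx) T
      refine exists_integralCurve_of_apriori_bound (contDiff_polyField p) _ (R := R) hT
        fun Z t ht hZ0 hZ i => ?_
      have := hR t ht _ (hsol Z t hZ0 hZ) (E.symm i)
      rwa [Equiv.apply_symm_apply] at this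

end

section

open Set

/-! ### Decimal encodings of tapes -/

theorem ten_mul_add_div_pow_succ (y s : ℕ) (hs : s < 10) (j : ℕ) :
    (10 * y + s) / 10 ^ (j + 1) = y / 10 ^ j := by
  rw [pow_succ', ← Nat.div_div_eq_div_mul]
  congr 1
  omega

theorem sum_digits_div_pow_mod (n : ℕ) (d : ℕ → ℕ) (hd : ∀ i, d i < 10) (j : ℕ) :
    (∑ i ∈ Finset.range n, d i * 10 ^ i) / 10 ^ j % 10 = if j < n then d j else 0 := by
  induction n generalizing d j with
  | zero => simp
  | succ n ih =>
    have h : ∑ i ∈ Finset.range (n + 1), d i * 10 ^ i =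
        10 * ∑ i ∈ Finset.range n, d (i + 1) * 10 ^ i + d 0 := by
      rw [Finset.sum_range_succ', Finset.mul_sum, pow_zero, mul_one]
      congr 1
      exact Finset.sum_congr rfl fun i _ => by ring
    rw [h]
    cases j with
    | zero =>
      have := hd 0
      simp
      omega
    | succ j =>
      rw [ten_mul_add_div_pow_succ _ _ (hd 0), ih (fun i => d (i + 1)) (fun i => hd _)]
      simp

theorem sum_div_pow_mod (n y : ℕ) :
    ∑ i ∈ Finset.range n, y / 10 ^ i % 10 * 10 ^ i = y % 10 ^ n := by
  induction n with
  | zero => simp [Nat.mod_one]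
  | succ n ih => rw [Finset.sum_range_succ, ih, Nat.mod_pow_succ, mul_comm]

namespace TuringMachine

variable {Q : Type*} {r : ℕ} {e : Q ≃ Fin r}

theorem isCode_iff {c : Config Q (Fin 10)} {x : ℕ × ℕ × ℕ} : IsCode e c x ↔
    (∀ i : ℕ, (c.2 (i : ℤ) : ℕ) = x.1 / 10 ^ i % 10) ∧
      (∀ i : ℕ, (c.2 (-((i : ℤ) + 1)) : ℕ) = x.2.1 / 10 ^ i % 10) ∧ x.2.2 = (e c.1 : ℕ) + 1 := by
  constructor
  · rintro ⟨k₀, h0, h1, h2, h3⟩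
    refine ⟨fun i => ?_, fun i => ?_, h3⟩
    · rw [h1, sum_digits_div_pow_mod _ (fun i => (c.2 (i : ℤ) : ℕ)) (fun i => (c.2 _).2)]
      split_ifs with h
      · rfl
      · rw [h0 _ (by rw [lt_abs]; omega)]
        rfl
    · rw [h2, sum_digits_div_pow_mod _ (fun i => (c.2 (-((i : ℤ) + 1)) : ℕ)) (fun i => (c.2 _).2)]
      split_ifs with h
      · rfl
      · rw [h0 _ (by rw [lt_abs]; omega)]
        rfl
  · rintro ⟨h1, h2, h3⟩
    have hlt : ∀ y i : ℕ, y ≤ i → y / 10 ^ i % 10 = 0 := fun y i h => by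
      rw [Nat.div_eq_of_lt (h.trans_lt (Nat.lt_pow_self (by norm_num)))]
    refine ⟨x.1 + x.2.1, fun n hn => ?_, ?_, ?_, h3⟩
    · rcases le_or_gt 0 n with h | h
      · obtain ⟨i, rfl⟩ := Int.eq_ofNat_of_zero_le h
        rw [abs_of_nonneg h] at hn
        exact Fin.ext ((h1 i).trans (hlt _ _ (by omega)))
      · obtain ⟨i, hi⟩ := Int.eq_ofNat_of_zero_le (show 0 ≤ -n - 1 by omega)
        obtain rfl : n = -((i : ℤ) + 1) := by omega
        rw [abs_of_neg h] at hn
        exact Fin.ext ((h2 i).trans (hlt _ _ (by omega)))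
    · simp only [h1]
      rw [sum_div_pow_mod, Nat.mod_eq_of_lt]
      calc x.1 < 10 ^ x.1 := Nat.lt_pow_self (by norm_num)
        _ ≤ _ := Nat.pow_le_pow_right (by norm_num) (by omega)
    · simp only [h2]
      rw [sum_div_pow_mod, Nat.mod_eq_of_lt]
      calc x.2.1 < 10 ^ x.2.1 := Nat.lt_pow_self (by norm_num)
        _ ≤ _ := Nat.pow_le_pow_right (by norm_num) (by omega)

theorem IsCode.eq {c c' : Config Q (Fin 10)} {x : ℕ × ℕ × ℕ} (h : IsCode e c x)
    (h' : IsCode e c' x) : c = c' := by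
  rw [isCode_iff] at h h'
  refine Prod.ext (e.injective (Fin.ext (by omega))) (funext fun n => Fin.ext ?_)
  rcases le_or_gt 0 n with hn | hn
  · obtain ⟨i, rfl⟩ := Int.eq_ofNat_of_zero_le hn
    exact (h.1 i).trans (h'.1 i).symm
  · obtain ⟨i, hi⟩ := Int.eq_ofNat_of_zero_le (show 0 ≤ -n - 1 by omega)
    obtain rfl : n = -((i : ℤ) + 1) := by omega
    exact (h.2.1 i).trans (h'.2.1 i).symm

theorem exists_isCode {x : ℕ × ℕ × ℕ} (h1 : 1 ≤ x.2.2) (h2 : x.2.2 ≤ r) :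
    ∃ c : Config Q (Fin 10), IsCode e c x := by
  refine ⟨(e.symm ⟨x.2.2 - 1, by omega⟩, fun n => if 0 ≤ n then
    ⟨x.1 / 10 ^ n.toNat % 10, Nat.mod_lt _ (by norm_num)⟩ else
    ⟨x.2.1 / 10 ^ (-n - 1).toNat % 10, Nat.mod_lt _ (by norm_num)⟩), ?_⟩
  rw [isCode_iff]
  refine ⟨fun i => ?_, fun i => ?_, ?_⟩
  · simp
  · have : ¬ (0 : ℤ) ≤ -((i : ℤ) + 1) := by omega
    simp only [if_neg this]
    have : (-(-((i : ℤ) + 1)) - 1).toNat = i := by omega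
    rw [this]
  · simp only [Equiv.apply_symm_apply]
    omega

/-! ### The transition function on codes -/

open Classical in
/-- The instruction executed at a code with residues `ρ` modulo `10 * (r + 1)`; there is none if the
residue of the third coordinate is not the number of a state, or is the number of the halting
state. -/
noncomputable def instruction (T : TuringMachine Q (Fin 10)) (e : Q ≃ Fin r)
    (ρ : Fin 3 → Fin (10 * (r + 1))) : Option (Q × Fin 10 × SignType) :=
  if h : 1 ≤ (ρ 2 : ℕ) ∧ (ρ 2 : ℕ) ≤ r then
    if e.symm ⟨ρ 2 - 1, by omega⟩ = T.qhalt then none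
    else some (T.δ (e.symm ⟨ρ 2 - 1, by omega⟩, ⟨ρ 0 % 10, Nat.mod_lt _ (by norm_num)⟩))
  else none

/-- The residues of a code. -/
def residues (r : ℕ) (x : ℕ × ℕ × ℕ) : Fin 3 → Fin (10 * (r + 1)) :=
  ![Fin.ofNat _ x.1, Fin.ofNat _ x.2.1, Fin.ofNat _ x.2.2]

/-- The transition function on codes, extended to all of `ℕ³`. -/
noncomputable def stepCode (T : TuringMachine Q (Fin 10)) (e : Q ≃ Fin r) (x : ℕ × ℕ × ℕ) :
    ℕ × ℕ × ℕ :=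
  match T.instruction e (residues r x) with
  | none => x
  | some (q, s, .zero) =>
    (10 * (x.1 / 10) + s, x.2.1, 10 * (r + 1) * (x.2.2 / (10 * (r + 1))) + (e q + 1))
  | some (q, s, .pos) =>
    (x.1 / 10, 10 * x.2.1 + s, 10 * (r + 1) * (x.2.2 / (10 * (r + 1))) + (e q + 1))
  | some (q, s, .neg) =>
    (10 * (10 * (x.1 / 10) + s) + x.2.1 % 10, x.2.1 / 10,
      10 * (r + 1) * (x.2.2 / (10 * (r + 1))) + (e q + 1))

theorem isCode_step {T : TuringMachine Q (Fin 10)} {c : Config Q (Fin 10)} {x : ℕ × ℕ × ℕ}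
    (h : IsCode e c x) : IsCode e (T.step c) (T.stepCode e x) := by
  have h' := h
  rw [isCode_iff] at h'
  obtain ⟨h1, h2, h3⟩ := h'
  have hr : (e c.1 : ℕ) < r := (e c.1).2
  have hmod : x.2.2 % (10 * (r + 1)) = (e c.1 : ℕ) + 1 := by
    rw [h3, Nat.mod_eq_of_lt (by omega)]
  have hdiv : x.2.2 / (10 * (r + 1)) = 0 := Nat.div_eq_of_lt (by omega)
  have hq : ∀ hlt, e.symm ⟨x.2.2 % (10 * (r + 1)) - 1, hlt⟩ = c.1 := fun hlt => by
    rw [Equiv.symm_apply_eq]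
    exact Fin.ext (by simp [hmod])
  have ha : (⟨x.1 % (10 * (r + 1)) % 10, Nat.mod_lt _ (by norm_num)⟩ : Fin 10) = c.2 0 := by
    have := h1 0
    simp only [Nat.cast_zero, pow_zero, Nat.div_one] at this
    exact Fin.ext (by simp [this])
  have hv : 1 ≤ (residues r x 2 : ℕ) ∧ (residues r x 2 : ℕ) ≤ r := by
    change 1 ≤ x.2.2 % (10 * (r + 1)) ∧ x.2.2 % (10 * (r + 1)) ≤ r
    omega
  by_cases hhalt : c.1 = T.qhalt
  · have hins : T.instruction e (residues r x) = none := by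
      rw [instruction, dif_pos hv]
      exact if_pos ((hq _).trans hhalt)
    rw [step, if_pos hhalt, stepCode, hins]
    exact h
  have hins : T.instruction e (residues r x) = some (T.δ (c.1, c.2 0)) := by
    rw [instruction, dif_pos hv]
    exact (if_neg fun hh => hhalt ((hq _).symm.trans hh)).trans
      (congrArg (fun p => some (T.δ p)) (Prod.ext (hq _) ha))
  rw [step, if_neg hhalt, stepCode, hins]
  obtain ⟨q, s, ε⟩ := T.δ (c.1, c.2 0)
  have hs := s.2
  have h10 : ∀ y i : ℕ, y / 10 / 10 ^ i = y / 10 ^ (i + 1) := fun y i => by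
    rw [Nat.div_div_eq_div_mul, pow_succ']
  have hzero : ∀ m : ℤ, m = 0 → Function.update c.2 0 s m = s := fun m hm => by
    rw [hm, Function.update_self]
  have hpos : ∀ (m : ℤ) (i : ℕ), m = i + 1 →
      (Function.update c.2 0 s m : ℕ) = x.1 / 10 ^ (i + 1) % 10 := fun m i hm => by
    rw [Function.update_of_ne (by omega), hm, ← h1]
    push_cast
    rfl
  have hneg : ∀ (m : ℤ) (i : ℕ), m = -(i + 1) →
      (Function.update c.2 0 s m : ℕ) = x.2.1 / 10 ^ i % 10 := fun m i hm => by
    rw [Function.update_of_ne (by omega), hm, ← h2]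
  rw [isCode_iff]
  cases ε with
  | zero =>
    dsimp only
    refine ⟨fun i => ?_, fun i => ?_, by simp [hdiv]⟩
    · cases i with
      | zero =>
        rw [hzero _ (by simp)]
        simp
        omega
      | succ i =>
        rw [hpos _ i (by simp), ten_mul_add_div_pow_succ _ _ hs, h10]
    · rw [hneg _ i (by simp)]
  | pos =>
    dsimp only
    refine ⟨fun i => ?_, fun i => ?_, by simp [hdiv]⟩
    · rw [hpos _ i (by simp), h10]
    · cases i with
      | zero =>
        rw [hzero _ (by simp)]
        simp
        omega
      | succ i =>
        rw [hneg _ i (by simp), ten_mul_add_div_pow_succ _ _ hs]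
  | neg =>
    dsimp only
    refine ⟨fun i => ?_, fun i => ?_, by simp [hdiv]⟩
    · match i with
      | 0 =>
        rw [hneg _ 0 (by simp)]
        simp
      | 1 =>
        rw [hzero _ (by simp), ten_mul_add_div_pow_succ _ _ (Nat.mod_lt _ (by norm_num))]
        simp
        omega
      | i + 2 =>
        rw [hpos _ i (by simp; ring), ten_mul_add_div_pow_succ _ _ (Nat.mod_lt _ (by norm_num)),
          ten_mul_add_div_pow_succ _ _ hs, h10]
    · rw [hneg _ (i + 1) (by simp; ring), h10]

theorem isCode_iterate_step {T : TuringMachine Q (Fin 10)} {c : Config Q (Fin 10)} {x : ℕ × ℕ × ℕ}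
    (h : IsCode e c x) (n : ℕ) : IsCode e (T.step^[n] c) ((T.stepCode e)^[n] x) := by
  induction n with
  | zero => exact h
  | succ n ih =>
    rw [Function.iterate_succ_apply', Function.iterate_succ_apply']
    exact isCode_step ih

theorem state_mem_of_stepCode {T : TuringMachine Q (Fin 10)} {x : ℕ × ℕ × ℕ}
    (h : 1 ≤ (T.stepCode e x).2.2 ∧ (T.stepCode e x).2.2 ≤ r) : 1 ≤ x.2.2 ∧ x.2.2 ≤ r := by
  cases hins : T.instruction e (residues r x) with
  | none =>
    rw [stepCode, hins] at h
    exact h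
  | some R =>
    have hv : 1 ≤ x.2.2 % (10 * (r + 1)) ∧ x.2.2 % (10 * (r + 1)) ≤ r := by
      by_contra hv
      change ¬(1 ≤ (residues r x 2 : ℕ) ∧ (residues r x 2 : ℕ) ≤ r) at hv
      rw [instruction, dif_neg hv] at hins
      exact Option.some_ne_none _ hins.symm
    have h2 : 10 * (r + 1) * (x.2.2 / (10 * (r + 1))) ≤ r := by
      obtain ⟨q, s, ε⟩ := R
      rw [stepCode, hins] at h
      cases ε <;> simp only at h <;> omega
    have h3 : x.2.2 / (10 * (r + 1)) = 0 := by
      by_contra hne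
      have : 10 * (r + 1) ≤ 10 * (r + 1) * (x.2.2 / (10 * (r + 1))) :=
        Nat.le_mul_of_pos_right _ (Nat.pos_of_ne_zero hne)
      omega
    have h4 := Nat.div_add_mod x.2.2 (10 * (r + 1))
    rw [h3] at h4
    omega

theorem exists_isCode_of_iterate {T : TuringMachine Q (Fin 10)} {c : Config Q (Fin 10)}
    {x : ℕ × ℕ × ℕ} {n : ℕ} (h : IsCode e c ((T.stepCode e)^[n] x)) :
    ∃ c₀ : Config Q (Fin 10), IsCode e c₀ x ∧ T.step^[n] c₀ = c := by
  have hv : 1 ≤ ((T.stepCode e)^[n] x).2.2 ∧ ((T.stepCode e)^[n] x).2.2 ≤ r := by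
    have h3 := (isCode_iff.1 h).2.2
    have := (e c.1).2
    omega
  have hx : 1 ≤ x.2.2 ∧ x.2.2 ≤ r := by
    clear h
    induction n with
    | zero => exact hv
    | succ n ih =>
      rw [Function.iterate_succ_apply'] at hv
      exact ih (state_mem_of_stepCode hv)
  obtain ⟨c₀, hc₀⟩ := exists_isCode (Q := Q) (e := e) hx.1 hx.2
  exact ⟨c₀, hc₀, (isCode_iterate_step hc₀ n).eq h⟩

/-- The linear part of the transition function on codes. -/
noncomputable def stepLinear (T : TuringMachine Q (Fin 10)) (e : Q ≃ Fin r)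
    (ρ : Fin 3 → Fin (10 * (r + 1))) (i j : Fin 3) : ℚ :=
  if i = j then
    match T.instruction e ρ with
    | none => 1
    | some (_, _, .zero) => 1
    | some (_, _, .pos) => ![1 / 10, 10, 1] i
    | some (_, _, .neg) => ![10, 1 / 10, 1] i
  else 0

/-- The constant part of the transition function on codes. -/
noncomputable def stepConst (T : TuringMachine Q (Fin 10)) (e : Q ≃ Fin r)
    (ρ : Fin 3 → Fin (10 * (r + 1))) : Fin 3 → ℚ :=
  match T.instruction e ρ with
  | none => 0
  | some (q, s, .zero) => ![s - (ρ 0 % 10 : ℕ), 0, e q + 1 - (ρ 2 : ℕ)]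
  | some (q, s, .pos) => ![-(ρ 0 % 10 : ℕ) / 10, s, e q + 1 - (ρ 2 : ℕ)]
  | some (q, s, .neg) =>
    ![10 * (s - (ρ 0 % 10 : ℕ)) + (ρ 1 % 10 : ℕ), -(ρ 1 % 10 : ℕ) / 10, e q + 1 - (ρ 2 : ℕ)]

/-- The point of `ℤ³` with coordinates `x`. -/
def toIntPoint (x : ℕ × ℕ × ℕ) : Fin 3 → ℤ := ![(x.1 : ℤ), x.2.1, x.2.2]

theorem isResidueOrbit_iterate_stepCode (T : TuringMachine Q (Fin 10)) (e : Q ≃ Fin r)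
    (x : ℕ × ℕ × ℕ) :
    IsResidueOrbit (T.stepLinear e) (T.stepConst e) fun n => toIntPoint ((T.stepCode e)^[n] x) := by
  intro n ρ hρ i
  simp only [Function.iterate_succ_apply']
  change ∀ l, _ ∣ toIntPoint ((T.stepCode e)^[n] x) l - _ at hρ
  generalize (T.stepCode e)^[n] x = y at hρ ⊢
  have hρy : ρ = residues r y := by
    funext l
    have h1 : ∀ (a b : ℕ), b < 10 * (r + 1) → ((10 * (r + 1) : ℕ) : ℤ) ∣ (a : ℤ) - b →
        b = a % (10 * (r + 1)) := fun a b hb hd => by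
      have := (Nat.modEq_iff_dvd.2 hd : b ≡ a [MOD 10 * (r + 1)])
      rwa [Nat.ModEq, Nat.mod_eq_of_lt hb] at this
    have h2 := h1 _ _ (ρ 0).2 (hρ 0)
    have h3 := h1 _ _ (ρ 1).2 (hρ 1)
    have h4 := h1 _ _ (ρ 2).2 (hρ 2)
    fin_cases l
    · exact Fin.ext h2
    · exact Fin.ext h3
    · exact Fin.ext h4
  subst hρy
  clear hρ
  have hdiag : ∑ j, T.stepLinear e (residues r y) i j * (toIntPoint y j : ℚ) =
      T.stepLinear e (residues r y) i i * (toIntPoint y i : ℚ) :=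
    Finset.sum_eq_single i (fun j _ hj => by rw [stepLinear, if_neg hj.symm, zero_mul]) (by simp)
  rw [hdiag, stepLinear, if_pos rfl, stepConst, stepCode]
  have hm : ∀ a : ℕ, ((a / 10 : ℕ) : ℚ) = (a - (a % 10 : ℕ)) / 10 := fun a => by
    have : ((10 * (a / 10) + a % 10 : ℕ) : ℚ) = a := by rw [Nat.div_add_mod]
    push_cast at this ⊢
    linarith
  have hmr : ∀ a : ℕ, a % (10 * (r + 1)) % 10 = a % 10 := fun a => Nat.mod_mul_right_mod _ _ _
  have hmN : 10 * ((r : ℚ) + 1) * (y.2.2 / (10 * (r + 1)) : ℕ) =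
      y.2.2 - (y.2.2 % (10 * (r + 1)) : ℕ) := by
    rw [eq_sub_iff_add_eq]
    exact_mod_cast Nat.div_add_mod y.2.2 (10 * (r + 1))
  have hcast : ∀ w i, (toIntPoint w i : ℚ) = ![(w.1 : ℚ), w.2.1, w.2.2] i := fun w i => by
    fin_cases i <;> simp [toIntPoint]
  rw [hcast, hcast]
  have h1 := hm y.1
  have h2 := hm y.2.1
  rcases T.instruction e (residues r y) with _ | ⟨q, s, ε⟩
  · simp
  · cases ε <;> fin_cases i <;> simp [residues, hmr] <;> linarith

end TuringMachine

end

namespace TuringMachine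

theorem isOpen_outputRegion {Q : Type*} {r : ℕ} (T : TuringMachine Q (Fin 10)) (e : Q ≃ Fin r)
    (m : ℕ) (δ ε : ℝ) {k : ℕ} (s : Set.Icc (-(k : ℤ)) (k : ℤ) → Fin 10) :
    IsOpen (T.outputRegion e m δ ε s) := by
  have h : T.outputRegion e m δ ε s =
      (⋃ i : ℕ, (fun Z : Fin (m + 4) → ℝ => Z 0) ⁻¹' Set.Ioo (i : ℝ) (i + δ)) ∩
        ⋃ (c : Config Q (Fin 10)) (x : ℕ × ℕ × ℕ)
          (_ : IsCode e c x ∧ c.1 = T.qhalt ∧ Carries c.2 s),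
          {Z : Fin (m + 4) → ℝ | (Z 1 - x.1) ^ 2 + (Z 2 - x.2.1) ^ 2 + (Z 3 - x.2.2) ^ 2 < ε ^ 2} := by
    ext Z
    simp [outputRegion, and_assoc]
  rw [h]
  refine (isOpen_iUnion fun i => isOpen_Ioo.preimage (continuous_apply 0)).inter
    (isOpen_iUnion fun c => isOpen_iUnion fun x => isOpen_iUnion fun _ =>
      isOpen_lt (by fun_prop) continuous_const)

end TuringMachine

theorem natCast_eq_of_abs_sub_lt {a b : ℕ} {y : ℝ} (ha : (y - a) ^ 2 < (1 / 4) ^ 2)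
    (hb : |y - b| ≤ 1 / 8) : a = b := by
  obtain ⟨h1, h2⟩ := abs_lt.1 (abs_lt_of_sq_lt_sq ha (by norm_num))
  obtain ⟨h3, h4⟩ := abs_le.1 hb
  have h5 : (a : ℝ) < b + 1 := by linarith
  have h6 : (b : ℝ) < a + 1 := by linarith
  norm_cast at h5 h6
  omega

/-- For every Turing machine `T` there is an autonomous polynomial vector field on `ℝ^(m+4)` with a
clock as first coordinate, and a point `y₀`, both with computable data, such that the orbit through
`(0, x₀, y₀)` meets the open set attached to a string `s` iff `T` halts on input `x₀` with an output
matching `s`. -/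
theorem proposition3p2 {Q : Type*} {r : ℕ} (e : Q ≃ Fin r) (T : TuringMachine Q (Fin 10)) :
    ∃ (m : ℕ) (p : Fin (m + 4) → MvPolynomial (Fin (m + 4)) ℝ) (y₀ : Fin m → ℝ) (δ ε : ℝ),
      p 0 = 1 ∧
      (∀ i d, IsComputableReal ((p i).coeff d)) ∧
      (∀ i, IsComputableReal (y₀ i)) ∧
      0 < δ ∧ δ ≤ 1 / 2 ∧ 0 < ε ∧ ε ≤ 1 / 4 ∧
      ∀ (k : ℕ) (s : Set.Icc (-(k : ℤ)) (k : ℤ) → Fin 10),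
        ∃ U : Set (Fin (m + 4) → ℝ), IsOpen U ∧ U = T.outputRegion e m δ ε s ∧
          ∀ x₀ : ℕ × ℕ × ℕ,
            (orbitThrough (polyField p) (initialPoint x₀ y₀) ∩ U).Nonempty ↔
              T.HaltsOnCode e x₀ s := by
  obtain ⟨m, p, y₀, hp0, hp, hy, hsim⟩ :=
    exists_polyField_simulating (T.stepLinear e) (T.stepConst e)
  refine ⟨m, p, y₀, 1 / 2, 1 / 4, hp0, hp, hy, by norm_num, le_rfl, by norm_num, le_rfl,
    fun k s => ⟨_, T.isOpen_outputRegion e m _ _ s, rfl, fun x₀ => ?_⟩⟩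
  obtain ⟨hfollow, hexists⟩ :=
    hsim _ x₀ (TuringMachine.isResidueOrbit_iterate_stepCode T e x₀) rfl
  constructor
  · rintro ⟨_, ⟨a, b, Z, ha, hb, hZ0, hZ, τ, hτ, rfl⟩, ⟨i, hi⟩, c, x, hcode, hhalt, hcar, hdist⟩
    obtain ⟨htime, hz⟩ := hfollow Z a b ha hb hZ0 hZ τ hτ
    rw [htime] at hi
    obtain ⟨h1, h2, h3⟩ := hz i hi.1.le hi.2.le
    have d1 := sq_nonneg (Z τ 1 - x.1)
    have d2 := sq_nonneg (Z τ 2 - x.2.1)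
    have d3 := sq_nonneg (Z τ 3 - x.2.2)
    simp only [TuringMachine.toIntPoint, Matrix.cons_val, Int.cast_natCast] at h1 h2 h3
    have hx : x = (T.stepCode e)^[i] x₀ :=
      Prod.ext (natCast_eq_of_abs_sub_lt (by linarith) h1)
        (Prod.ext (natCast_eq_of_abs_sub_lt (by linarith) h2)
          (natCast_eq_of_abs_sub_lt (by linarith) h3))
    subst hx
    obtain ⟨c₀, hc₀, rfl⟩ := TuringMachine.exists_isCode_of_iterate hcode
    exact ⟨c₀, hc₀, i, hhalt, hcar⟩
  · rintro ⟨c, hc, j, hhalt, hcar⟩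
    obtain ⟨Z, a, ha, hZ0, hZ⟩ := hexists (j + 1) (by positivity)
    have hj : (0 : ℝ) ≤ j := Nat.cast_nonneg j
    have hτ : (j : ℝ) + 1 / 4 ∈ Set.Ioo a (j + 1) := ⟨by linarith, by linarith⟩
    obtain ⟨htime, hz⟩ := hfollow Z a (j + 1) ha (by linarith) hZ0 hZ _ hτ
    obtain ⟨h1, h2, h3⟩ := hz j (by linarith) (by linarith)
    refine ⟨Z (j + 1 / 4), ⟨a, j + 1, Z, ha, by linarith, hZ0, hZ, _, hτ, rfl⟩, ⟨j, ?_⟩,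
      T.step^[j] c, (T.stepCode e)^[j] x₀, TuringMachine.isCode_iterate_step hc j, hhalt, hcar, ?_⟩
    · rw [htime]
      constructor <;> linarith
    · rw [← sq_abs (Z _ 1 - _), ← sq_abs (Z _ 2 - _), ← sq_abs (Z _ 3 - _)]
      have h1' := pow_le_pow_left₀ (abs_nonneg _) h1 2
      have h2' := pow_le_pow_left₀ (abs_nonneg _) h2 2
      have h3' := pow_le_pow_left₀ (abs_nonneg _) h3 2
      simp only [TuringMachine.toIntPoint, Matrix.cons_val, Int.cast_natCast] at h1' h2' h3'
      linarith
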